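/- Let $k$ be an algebraically closed field of characteristic $0$, let $n\ge 1$, and let $q\in k$ satisfy $q^n=1$ and have multiplicative order $d\ge 2$ (so $d\mid n$ and $n\ge 2$). Let $k\mathcal Z(q)$ be the $k$-vector space with basis $\{p_i^l : i\in\mathbb Z/n,\ l\ge 0\}$ (the paths of the $n$-cyclic quiver, $p_i^l$ being the path of length $l$ with source $i$), with the Hopf algebra structure given by $$\Delta(p_i^l)=\sum_{s+t=l}p_{i+s}^{t}\otimes p_i^{s},\qquad \varepsilon(p_i^l)=\delta_{l,0},\qquad p_i^l\cdot p_j^m=q^{im}\binom{l+m}{l}_q\,p_{i+j}^{l+m},\qquad 1=p_0^0,$$ where $\binom{l+m}{l}_q$ is the value at $q$ of the Gaussian binomial polynomial. Let $\mathcal C_q$ be the tensor category of finite-dimensional right $k\mathcal Z(q)$-comodules, the coaction on $U\otimes W$ being $u\otimes w\mapsto u_0\otimes w_0\otimes u_1w_1$. Its Green ring $\mathcal{GR}(\mathcal C_q)$ is the free abelian group on the isomorphism classes $[X]$ of objects of $\mathcal C_q$, modulo the relations $[Y]=[X]+[Z]$ for all split short exact sequences $0\to X\to Y\to Z\to 0$,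 with the multiplication $[X]\cdot[Y]=[X\otimes Y]$. For $i\in\mathbb Z/n$ and $l\ge 0$ let $V(i,l)$ be the comodule with basis $v_0,\dots,v_l$ and coaction $v_m\mapsto\sum_{j=m}^{l}v_j\otimes p_{i+m}^{j-m}$. Then there is a ring isomorphism $$\mathbb Z[x,y,z]/J\;\cong\;\mathcal{GR}(\mathcal C_q)$$ sending the classes of $x,y,z$ to $[V(1,0)],[V(0,1)],[V(0,d)]$ respectively, where $J$ is the ideal of $\mathbb Z[x,y,z]$ generated by $$x^n-1\qquad\text{and}\qquad (y-x-1)\sum_{i=0}^{\lfloor (d-1)/2\rfloor}(-1)^i\binom{d-1-i}{i}x^i y^{d-1-2i}.$$ -/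

import Mathlib

open scoped TensorProduct

universe u v

/-! ### Gaussian binomials -/

section Gaussian

open Finset.HasAntidiagonal

variable {R : Type*} [CommRing R]

/-- The `q`-integer `l_q = 1 + q + ⋯ + q ^ (l - 1)`. -/
def qInt (q : R) (l : ℕ) : R := ∑ i ∈ Finset.range l, q ^ i

/-- The `q`-factorial `l!_q = 1_q 2_q ⋯ l_q`. -/
def qFact (q : R) (l : ℕ) : R := ∏ i ∈ Finset.range l, qInt q (i + 1)

/-- The Gaussian binomial, defined by the `q`-Pascal rule. It is the value at `q` of the polynomial
`m!_X / (l!_X (m - l)!_X)` (see `qBinom_mul_qFact`), also where `l!_q` vanishes. -/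
def qBinom (q : R) : ℕ → ℕ → R
  | _, 0 => 1
  | 0, _ + 1 => 0
  | m + 1, l + 1 => qBinom q m l + q ^ (l + 1) * qBinom q m (l + 1)

@[simp] theorem qBinom_zero_right (q : R) (m : ℕ) : qBinom q m 0 = 1 := by
  cases m <;> rfl

theorem qBinom_succ_succ (q : R) (m l : ℕ) :
    qBinom q (m + 1) (l + 1) = qBinom q m l + q ^ (l + 1) * qBinom q m (l + 1) := rfl

theorem qBinom_eq_zero (q : R) : ∀ {m l : ℕ}, m < l → qBinom q m l = 0
  | _, 0, h => absurd h (Nat.not_lt_zero _)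
  | 0, _ + 1, _ => rfl
  | m + 1, l + 1, h => by
    rw [qBinom_succ_succ, qBinom_eq_zero q (by omega), qBinom_eq_zero q (by omega)]
    simp

@[simp] theorem qBinom_self (q : R) : ∀ m : ℕ, qBinom q m m = 1
  | 0 => rfl
  | m + 1 => by
    rw [qBinom_succ_succ, qBinom_self q m, qBinom_eq_zero q (Nat.lt_succ_self m)]
    simp

theorem qInt_add (q : R) (l m : ℕ) : qInt q (l + m) = qInt q l + q ^ l * qInt q m := by
  simp [qInt, Finset.sum_range_add, Finset.mul_sum, pow_add]

theorem qFact_succ (q : R) (l : ℕ) : qFact q (l + 1) = qFact q l * qInt q (l + 1) := by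
  simp [qFact, Finset.prod_range_succ]

theorem qBinom_mul_qFact (q : R) :
    ∀ l m : ℕ, qBinom q (l + m) l * (qFact q l * qFact q m) = qFact q (l + m)
  | 0, m => by simp [qFact]
  | l + 1, 0 => by simp [qFact]
  | l + 1, m + 1 => by
    have h1 := qBinom_mul_qFact q l (m + 1)
    have h2 := qBinom_mul_qFact q (l + 1) m
    have e1 : l + (m + 1) = l + m + 1 := by omega
    have e2 : l + 1 + m = l + m + 1 := by omega
    have e3 : l + 1 + (m + 1) = l + m + 1 + 1 := by omega
    rw [e1] at h1
    rw [e2] at h2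
    rw [e3, qBinom_succ_succ, qFact_succ q (l + m + 1),
      show l + m + 1 + 1 = (l + 1) + (m + 1) by omega, qInt_add q (l + 1) (m + 1),
      mul_add]
    have f1 := qFact_succ q l
    have f2 := qFact_succ q m
    calc _ = (qBinom q (l + m + 1) l * (qFact q l * qFact q (m + 1))) * qInt q (l + 1)
        + q ^ (l + 1) * (qBinom q (l + m + 1) (l + 1) * (qFact q (l + 1) * qFact q m))
          * qInt q (m + 1) := by rw [f1, f2]; ring
      _ = _ := by rw [h1, h2]; ring

theorem map_qBinom {S : Type*} [CommRing S] (f : R →+* S) (q : R) :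
    ∀ m l : ℕ, f (qBinom q m l) = qBinom (f q) m l
  | _, 0 => by simp
  | 0, _ + 1 => by simp [qBinom]
  | m + 1, l + 1 => by simp [qBinom_succ_succ, map_qBinom f q m]

theorem qFact_X_ne_zero (l : ℕ) : qFact (Polynomial.X : Polynomial ℤ) l ≠ 0 := by
  refine Finset.prod_ne_zero_iff.2 fun i _ h => ?_
  have := congrArg (Polynomial.eval 1) h
  simp [qInt, Polynomial.eval_finsetSum] at this
  omega

theorem qBinom_symm (q : R) (l m : ℕ) : qBinom q (l + m) l = qBinom q (m + l) m := by
  have h1 := qBinom_mul_qFact (Polynomial.X : Polynomial ℤ) l m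
  have h2 := qBinom_mul_qFact (Polynomial.X : Polynomial ℤ) m l
  rw [add_comm m l, ← h1, mul_comm (qFact _ m)] at h2
  have key := mul_right_cancel₀ (mul_ne_zero (qFact_X_ne_zero l) (qFact_X_ne_zero m)) h2
  have := congrArg (Polynomial.eval₂RingHom (Int.castRingHom R) q) key
  rw [add_comm m l]
  simpa only [map_qBinom, Polynomial.coe_eval₂RingHom, Polynomial.eval₂_X] using this.symm

/-- Both sides are the `q`-trinomial coefficient. -/
theorem qBinom_assoc (q : R) (l m r : ℕ) :
    qBinom q (l + m) l * qBinom q (l + m + r) (l + m)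
      = qBinom q (m + r) m * qBinom q (l + (m + r)) l := by
  have key : qBinom (Polynomial.X : Polynomial ℤ) (l + m) l * qBinom Polynomial.X (l + m + r) (l + m)
      = qBinom Polynomial.X (m + r) m * qBinom Polynomial.X (l + (m + r)) l := by
    have h1 := qBinom_mul_qFact (Polynomial.X : Polynomial ℤ) l m
    have h2 := qBinom_mul_qFact (Polynomial.X : Polynomial ℤ) (l + m) r
    have h3 := qBinom_mul_qFact (Polynomial.X : Polynomial ℤ) m r
    have h4 := qBinom_mul_qFact (Polynomial.X : Polynomial ℤ) l (m + r)
    have hne : qFact (Polynomial.X : Polynomial ℤ) l * qFact Polynomial.X m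
        * qFact Polynomial.X r ≠ 0 :=
      mul_ne_zero (mul_ne_zero (qFact_X_ne_zero l) (qFact_X_ne_zero m)) (qFact_X_ne_zero r)
    refine mul_right_cancel₀ hne ?_
    rw [← add_assoc] at h4 ⊢
    rw [← h1] at h2
    rw [← h3, ← h2] at h4
    linear_combination -h4
  have := congrArg (Polynomial.eval₂RingHom (Int.castRingHom R) q) key
  rw [map_mul, map_mul] at this
  simpa only [map_qBinom, Polynomial.coe_eval₂RingHom, Polynomial.eval₂_X] using this

/-- The `q`-Vandermonde identity. -/
theorem qBinom_vandermonde (q : R) (S : ℕ) : ∀ T l : ℕ,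
    ∑ x ∈ antidiagonal l, q ^ (x.1 * (T - x.2)) * qBinom q S x.1 * qBinom q T x.2
      = qBinom q (S + T) l
  | 0, l => by
    rw [Finset.sum_eq_single (l, 0)]
    · simp
    · rintro ⟨s, t⟩ h hne
      rw [mem_antidiagonal] at h
      rcases Nat.eq_zero_or_pos t with rfl | ht
      · simp at h; subst h; exact absurd rfl hne
      · simp [qBinom_eq_zero q ht]
    · simp
  | T + 1, 0 => by simp
  | T + 1, l + 1 => by
    have h1 := qBinom_vandermonde q S T l
    have h2 := qBinom_vandermonde q S T (l + 1)
    have key : ∑ x ∈ antidiagonal l,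
        q ^ (x.1 * (T + 1 - (x.2 + 1))) * qBinom q S x.1 * qBinom q (T + 1) (x.2 + 1)
        = ∑ x ∈ antidiagonal l, q ^ (x.1 * (T - x.2)) * qBinom q S x.1 * qBinom q T x.2
          + q ^ (l + 1) * ∑ x ∈ antidiagonal l,
            q ^ (x.1 * (T - (x.2 + 1))) * qBinom q S x.1 * qBinom q T (x.2 + 1) := by
      rw [Finset.mul_sum, ← Finset.sum_add_distrib]
      refine Finset.sum_congr rfl ?_
      rintro ⟨s, t⟩ h
      rw [mem_antidiagonal] at h
      simp only at h ⊢
      rw [qBinom_succ_succ, Nat.add_sub_add_right]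
      rcases Nat.lt_or_ge T (t + 1) with ht | ht
      · rw [qBinom_eq_zero q ht]; ring
      · obtain ⟨c, rfl⟩ := Nat.exists_eq_add_of_le ht
        rw [show t + 1 + c - t = c + 1 by omega, show t + 1 + c - (t + 1) = c by omega, ← h]
        ring
    rw [Finset.Nat.sum_antidiagonal_succ'] at h2 ⊢
    rw [← add_assoc, qBinom_succ_succ, ← h1, ← h2, key]
    simp
    ring

theorem qBinom_alternating (q : R) (l : ℕ) (hl : l ≠ 0) :
    ∑ x ∈ antidiagonal l, (-1) ^ x.1 * q ^ (x.1.choose 2) * qBinom q l x.1 = 0 := by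
  obtain ⟨l, rfl⟩ := Nat.exists_eq_succ_of_ne_zero hl
  have h (j : ℕ) : ∑ s ∈ Finset.range (j + 1),
      (-1) ^ s * q ^ (s.choose 2) * qBinom q (l + 1) s
      = (-1) ^ j * q ^ ((j + 1).choose 2) * qBinom q l j := by
    induction j with
    | zero => simp
    | succ j ih =>
      have e : (j + 1 + 1).choose 2 = j + 1 + (j + 1).choose 2 := by
        rw [Nat.choose_succ_succ' (j + 1) 1, Nat.choose_one_right]
      rw [Finset.sum_range_succ, ih, qBinom_succ_succ, e]
      ring
  rw [Finset.Nat.sum_antidiagonal_eq_sum_range_succ_mk]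
  simp only
  rw [h, qBinom_eq_zero q (Nat.lt_succ_self l), mul_zero]

end Gaussian

/-! ### The bialgebra `k𝒵(q)` -/

/-- The underlying space of `k𝒵(q)`: the span of the paths of the `n`-cyclic quiver, which has the
vertices `i : ZMod n` and one arrow `i → i + 1` for each `i`. A path is determined by its source
`i` and its length `l`, so that the path `p_i^l` is the pair `(i, l)`. -/
def CyclicHopf {k : Type u} [Field k] (n : ℕ) [NeZero n] (q : k) (_hq : q ^ n = 1) : Type u :=
  (ZMod n × ℕ) →₀ k

namespace CyclicHopf

open Finset.HasAntidiagonal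

variable {k : Type u} [Field k] {n : ℕ} [NeZero n] {q : k} {hq : q ^ n = 1}

noncomputable instance : AddCommGroup (CyclicHopf n q hq) :=
  inferInstanceAs (AddCommGroup ((ZMod n × ℕ) →₀ k))

noncomputable instance : Module k (CyclicHopf n q hq) :=
  inferInstanceAs (Module k ((ZMod n × ℕ) →₀ k))

variable (n q hq) in
/-- The basis of all paths. -/
noncomputable def pathBasis : Module.Basis (ZMod n × ℕ) k (CyclicHopf n q hq) :=
  .ofRepr (LinearEquiv.refl k ((ZMod n × ℕ) →₀ k))

variable (n q hq) in
/-- The path `p_i^l` with source `i` and length `l`. -/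
noncomputable def path (i : ZMod n) (l : ℕ) : CyclicHopf n q hq := pathBasis n q hq (i, l)

/-- The `n`-th root of unity `q ^ i`, for `i` in `ZMod n`. -/
def qPow (q : k) (i : ZMod n) : k := q ^ i.val

variable (n q hq) in
/-- The product `p_i^l * p_j^m = q^{im} (l+m choose l)_q p_{i+j}^{l+m}`. -/
noncomputable def mulMap :
    CyclicHopf n q hq →ₗ[k] CyclicHopf n q hq →ₗ[k] CyclicHopf n q hq :=
  (pathBasis n q hq).constr k fun x => (pathBasis n q hq).constr k fun y =>
    (qPow q x.1 ^ y.2 * qBinom q (x.2 + y.2) x.2) • path n q hq (x.1 + y.1) (x.2 + y.2)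

variable (n q hq) in
/-- The splitting of paths: `Δ(p_i^l) = ∑_{s+t=l} p_{i+s}^t ⊗ p_i^s`. -/
noncomputable def comulMap :
    CyclicHopf n q hq →ₗ[k] CyclicHopf n q hq ⊗[k] CyclicHopf n q hq :=
  (pathBasis n q hq).constr k fun x =>
    ∑ y ∈ antidiagonal x.2, path n q hq (x.1 + y.1) y.2 ⊗ₜ[k] path n q hq x.1 y.1

variable (n q hq) in
/-- The counit: `ε(p_i^l)` is `1` for `l = 0` and `0` otherwise. -/
noncomputable def counitMap : CyclicHopf n q hq →ₗ[k] k :=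
  (pathBasis n q hq).constr k fun x => if x.2 = 0 then 1 else 0

theorem qPow_add (hq : q ^ n = 1) (i j : ZMod n) : qPow q (i + j) = qPow q i * qPow q j := by
  rw [qPow, qPow, qPow, ZMod.val_add, ← pow_eq_pow_mod _ hq, pow_add]

theorem qPow_natCast {n : ℕ} (hq : q ^ n = 1) (s : ℕ) : qPow q (s : ZMod n) = q ^ s := by
  rw [qPow, ZMod.val_natCast, ← pow_eq_pow_mod _ hq]

theorem qPow_zero {n : ℕ} : qPow q (0 : ZMod n) = 1 := by simp [qPow]

theorem mulMap_path (i j : ZMod n) (l m : ℕ) :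
    mulMap n q hq (path n q hq i l) (path n q hq j m)
      = (qPow q i ^ m * qBinom q (l + m) l) • path n q hq (i + j) (l + m) := by
  simp only [mulMap, path, Module.Basis.constr_basis]

theorem comulMap_path (i : ZMod n) (l : ℕ) :
    comulMap n q hq (path n q hq i l)
      = ∑ y ∈ antidiagonal l, path n q hq (i + y.1) y.2 ⊗ₜ[k] path n q hq i y.1 := by
  simp only [comulMap, path, Module.Basis.constr_basis]

theorem counitMap_path (i : ZMod n) (l : ℕ) :
    counitMap n q hq (path n q hq i l) = if l = 0 then 1 else 0 := by
  simp only [counitMap, path, Module.Basis.constr_basis]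

theorem hom_ext {M : Type*} [AddCommMonoid M] [Module k M] {f g : CyclicHopf n q hq →ₗ[k] M}
    (h : ∀ i l, f (path n q hq i l) = g (path n q hq i l)) : f = g :=
  (pathBasis n q hq).ext fun x => h x.1 x.2

noncomputable instance : Mul (CyclicHopf n q hq) := ⟨fun a b => mulMap n q hq a b⟩

noncomputable instance : One (CyclicHopf n q hq) := ⟨path n q hq 0 0⟩

theorem mul_def (a b : CyclicHopf n q hq) : a * b = mulMap n q hq a b := rfl

theorem one_def : (1 : CyclicHopf n q hq) = path n q hq 0 0 := rfl

theorem path_mul_path (i j : ZMod n) (l m : ℕ) :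
    path n q hq i l * path n q hq j m
      = (qPow q i ^ m * qBinom q (l + m) l) • path n q hq (i + j) (l + m) :=
  mulMap_path i j l m

theorem mulMap_one_left : mulMap n q hq 1 = LinearMap.id :=
  hom_ext fun i l => by simp [one_def, mulMap_path, qPow_zero]

theorem mulMap_one_right : (mulMap n q hq).flip 1 = LinearMap.id :=
  hom_ext fun i l => by simp [one_def, mulMap_path]

theorem mulMap_assoc (a b c : CyclicHopf n q hq) :
    mulMap n q hq (mulMap n q hq a b) c = mulMap n q hq a (mulMap n q hq b c) := by
  have h : (mulMap n q hq).compr₂ (mulMap n q hq)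
      = ((LinearMap.llcomp k _ _ _).flip ∘ₗ mulMap n q hq).flip.compr₂ .id ∘ₗ mulMap n q hq := by
    refine hom_ext fun i l => hom_ext fun j m => hom_ext fun t r => ?_
    simp only [LinearMap.compr₂_apply, LinearMap.comp_apply, LinearMap.flip_apply,
      LinearMap.llcomp_apply, LinearMap.id_apply, mulMap_path, map_smul, LinearMap.smul_apply,
      smul_smul, add_assoc]
    congr 1
    have := qBinom_assoc q l m r
    rw [add_assoc l m r] at this
    rw [qPow_add hq]
    linear_combination qPow q i ^ m * qPow q i ^ r * qPow q j ^ r * this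
  exact LinearMap.congr_fun (LinearMap.congr_fun (LinearMap.congr_fun h a) b) c

noncomputable instance : Ring (CyclicHopf n q hq) :=
  { (inferInstance : AddCommGroup (CyclicHopf n q hq)) with
    mul := (· * ·)
    one := 1
    left_distrib := fun a b c => map_add (mulMap n q hq a) b c
    right_distrib := fun a b c => by simp [mul_def]
    zero_mul := fun a => by simp [mul_def]
    mul_zero := fun a => by simp [mul_def]
    mul_assoc := mulMap_assoc
    one_mul := LinearMap.congr_fun mulMap_one_left
    mul_one := LinearMap.congr_fun mulMap_one_right }

noncomputable instance : Algebra k (CyclicHopf n q hq) :=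
  Algebra.ofModule (fun r a b => by simp [mul_def]) (fun r a b => by simp [mul_def])

theorem sum_antidiagonal_assoc {M : Type*} [AddCommMonoid M] (l : ℕ) (f : ℕ → ℕ → ℕ → M) :
    ∑ x ∈ antidiagonal l, ∑ y ∈ antidiagonal x.2, f x.1 y.1 y.2
      = ∑ x ∈ antidiagonal l, ∑ y ∈ antidiagonal x.1, f y.1 y.2 x.2 := by
  rw [Finset.sum_sigma', Finset.sum_sigma']
  refine Finset.sum_bij' (fun a _ => ⟨(a.1.1 + a.2.1, a.2.2), (a.1.1, a.2.1)⟩)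
    (fun a _ => ⟨(a.2.1, a.2.2 + a.1.2), (a.2.2, a.1.2)⟩) ?_ ?_ ?_ ?_ ?_
  all_goals
    rintro ⟨⟨a, b⟩, ⟨c, d⟩⟩ h
    simp only [Finset.mem_sigma, mem_antidiagonal] at h
    obtain ⟨rfl, h⟩ := h
    subst h
    simp [add_assoc]

noncomputable instance : Coalgebra k (CyclicHopf n q hq) where
  comul := comulMap n q hq
  counit := counitMap n q hq
  coassoc := hom_ext fun i l => by
    simp only [LinearMap.comp_apply, comulMap_path, map_sum, LinearMap.rTensor_tmul,
      LinearMap.lTensor_tmul, TensorProduct.sum_tmul, TensorProduct.tmul_sum,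
      LinearEquiv.coe_coe, TensorProduct.assoc_tmul]
    rw [sum_antidiagonal_assoc l fun a b c => path n q hq (i + a + b) c ⊗ₜ[k]
      (path n q hq (i + a) b ⊗ₜ[k] path n q hq i a)]
    refine Finset.sum_congr rfl ?_
    rintro ⟨a, b⟩ h
    refine Finset.sum_congr rfl ?_
    rintro ⟨c, d⟩ h'
    rw [mem_antidiagonal] at h'
    simp only at h' ⊢
    rw [← h', Nat.cast_add, add_assoc]
  rTensor_counit_comp_comul := hom_ext fun i l => by
    simp only [LinearMap.comp_apply, comulMap_path, map_sum, LinearMap.rTensor_tmul,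
      counitMap_path, TensorProduct.mk_apply]
    rw [Finset.sum_eq_single (l, 0)]
    · simp
    · rintro ⟨a, b⟩ h hne
      have : b ≠ 0 := by rintro rfl; simp at h; exact hne (by rw [h])
      simp [this]
    · simp
  lTensor_counit_comp_comul := hom_ext fun i l => by
    simp only [LinearMap.comp_apply, comulMap_path, map_sum, LinearMap.lTensor_tmul,
      counitMap_path, LinearMap.flip_apply, TensorProduct.mk_apply]
    rw [Finset.sum_eq_single (0, l)]
    · simp
    · rintro ⟨a, b⟩ h hne
      have : a ≠ 0 := by rintro rfl; simp at h; exact hne (by rw [h])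
      simp [this]
    · simp

theorem comul_path (i : ZMod n) (l : ℕ) :
    Coalgebra.comul (R := k) (path n q hq i l)
      = ∑ y ∈ antidiagonal l, path n q hq (i + y.1) y.2 ⊗ₜ[k] path n q hq i y.1 :=
  comulMap_path i l

theorem counit_path (i : ZMod n) (l : ℕ) :
    Coalgebra.counit (R := k) (path n q hq i l) = if l = 0 then 1 else 0 :=
  counitMap_path i l

theorem sum_antidiagonal_shift {M : Type*} [AddCommMonoid M] (s t m : ℕ) (f : ℕ → ℕ → M)
    (h0 : ∀ a b, a < s ∨ b < t → f a b = 0) :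
    ∑ y ∈ antidiagonal m, f (s + y.1) (t + y.2) = ∑ z ∈ antidiagonal (s + t + m), f z.1 z.2 := by
  refine Finset.sum_of_injOn (fun y => (s + y.1, t + y.2)) ?_ ?_ ?_ ?_
  · rintro ⟨a, b⟩ _ ⟨c, d⟩ _ h
    simp at h
    simp [h]
  · rintro ⟨a, b⟩ h
    simp at h ⊢
    omega
  · rintro ⟨a, b⟩ h hn
    refine h0 a b ?_
    by_contra! hc
    refine hn ⟨(a - s, b - t), ?_, ?_⟩
    · simp at h ⊢
      omega
    · simp
      omega
  · intros; rfl

theorem comul_path_mul (i j : ZMod n) (l m : ℕ) :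
    Coalgebra.comul (R := k) (path n q hq i l * path n q hq j m)
      = Coalgebra.comul (R := k) (path n q hq i l) * Coalgebra.comul (R := k) (path n q hq j m) := by
  rw [path_mul_path, map_smul, comul_path, comul_path, comul_path, Finset.sum_mul]
  have h1 : ∀ x ∈ antidiagonal l,
      (path n q hq (i + x.1) x.2 ⊗ₜ[k] path n q hq i x.1) *
        ∑ y ∈ antidiagonal m, path n q hq (j + y.1) y.2 ⊗ₜ[k] path n q hq j y.1
      = ∑ z ∈ antidiagonal (l + m), (qPow q i ^ m *
          (q ^ (x.1 * (z.2 - x.2)) * qBinom q z.1 x.1 * qBinom q z.2 x.2)) •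
          (path n q hq (i + j + z.1) z.2 ⊗ₜ[k] path n q hq (i + j) z.1) := by
    rintro ⟨s, t⟩ hx
    rw [mem_antidiagonal] at hx
    simp only at hx ⊢
    rw [← hx, ← sum_antidiagonal_shift s t m fun a b => (qPow q i ^ m *
          (q ^ (s * (b - t)) * qBinom q a s * qBinom q b t)) •
          (path n q hq (i + j + a) b ⊗ₜ[k] path n q hq (i + j) a), Finset.mul_sum]
    · refine Finset.sum_congr rfl ?_
      rintro ⟨s', t'⟩ hy
      rw [mem_antidiagonal] at hy
      simp only at hy ⊢
      rw [Algebra.TensorProduct.tmul_mul_tmul, path_mul_path, path_mul_path,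
        TensorProduct.smul_tmul_smul, qPow_add hq, qPow_natCast hq, ← hy,
        Nat.add_sub_cancel_left, show i + s + (j + s') = i + j + ((s + s' : ℕ) : ZMod n) by
          push_cast; ring]
      congr 1
      ring
    · rintro a b (h | h)
      · simp [qBinom_eq_zero q h]
      · simp [qBinom_eq_zero q h]
  rw [Finset.sum_congr rfl h1, Finset.sum_comm, Finset.smul_sum]
  refine Finset.sum_congr rfl ?_
  rintro ⟨S, T⟩ hz
  rw [mem_antidiagonal] at hz
  simp only at hz ⊢
  rw [← Finset.sum_smul, ← Finset.mul_sum, qBinom_vandermonde, hz]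

noncomputable instance : Bialgebra k (CyclicHopf n q hq) where
  counit_one := by rw [one_def, counit_path]; simp
  mul_compr₂_counit := hom_ext fun i l => hom_ext fun j m => by
    simp only [LinearMap.compr₂_apply, LinearMap.mul_apply', LinearMap.compl₁₂_apply,
      path_mul_path, map_smul, counit_path]
    rcases Nat.eq_zero_or_pos l with rfl | hl
    · rcases Nat.eq_zero_or_pos m with rfl | hm
      · simp
      · simp [hm.ne']
    · simp [hl.ne']
  comul_one := by
    rw [one_def, comul_path]
    simp [Algebra.TensorProduct.one_def, one_def]
  mul_compr₂_comul := hom_ext fun i l => hom_ext fun j m => comul_path_mul i j l m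

theorem qPow_ne_zero (hq : q ^ n = 1) (i : ZMod n) : qPow q i ≠ 0 := by
  refine pow_ne_zero _ ?_
  rintro rfl
  rw [zero_pow (NeZero.ne n)] at hq
  exact zero_ne_one hq

/-- The bialgebra `k𝒵(q)` is a Hopf algebra. -/
theorem exists_antipode : ∃ S : CyclicHopf n q hq →ₗ[k] CyclicHopf n q hq,
    LinearMap.mul' k _ ∘ₗ S.rTensor _ ∘ₗ Coalgebra.comul
      = Algebra.linearMap k (CyclicHopf n q hq) ∘ₗ Coalgebra.counit ∧
    LinearMap.mul' k _ ∘ₗ S.lTensor _ ∘ₗ Coalgebra.comul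
      = Algebra.linearMap k (CyclicHopf n q hq) ∘ₗ Coalgebra.counit := by
  have hq0 : q ≠ 0 := by
    rintro rfl
    rw [zero_pow (NeZero.ne n)] at hq
    exact zero_ne_one hq
  let S : CyclicHopf n q hq →ₗ[k] CyclicHopf n q hq := (pathBasis n q hq).constr k fun x =>
    ((-1) ^ x.2 * (qPow q x.1 ^ x.2 * q ^ ((x.2 + 1).choose 2))⁻¹) • path n q hq (-x.1 - (x.2 : ZMod n)) x.2
  have hS (i : ZMod n) (l : ℕ) : S (path n q hq i l) =
      ((-1) ^ l * (qPow q i ^ l * q ^ ((l + 1).choose 2))⁻¹) • path n q hq (-i - (l : ZMod n)) l := by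
    simp only [S, path, Module.Basis.constr_basis]
  have hch (s : ℕ) : s * s = (s + 1).choose 2 + s.choose 2 := by
    induction s with
    | zero => rfl
    | succ s ih =>
      have e1 : (s + 1 + 1).choose 2 = s + 1 + (s + 1).choose 2 := by
        rw [Nat.choose_succ_succ' (s + 1) 1, Nat.choose_one_right]
      have e2 : (s + 1).choose 2 = s + s.choose 2 := by
        rw [Nat.choose_succ_succ' s 1, Nat.choose_one_right]
      nlinarith
  refine ⟨S, hom_ext fun i l => ?_, hom_ext fun i l => ?_⟩
  · have key : ∀ x ∈ antidiagonal l, S (path n q hq (i + x.1) x.2) * path n q hq i x.1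
        = ((qPow q i ^ l * q ^ (l * l))⁻¹ *
          ((-1) ^ x.2 * q ^ (x.2.choose 2) * qBinom q l x.2)) • path n q hq (-(l : ZMod n)) l := by
      rintro ⟨s, t⟩ h
      rw [mem_antidiagonal] at h
      simp only at h ⊢
      rw [hS, smul_mul_assoc, path_mul_path, smul_smul, add_comm t s, h,
        show -(i + (s : ZMod n)) - (t : ZMod n) + i = -(l : ZMod n) by rw [← h]; push_cast; ring]
      congr 1
      have h1 : qPow q (-(i + (s : ZMod n)) - (t : ZMod n)) = (qPow q i * q ^ l)⁻¹ := by
        refine eq_inv_of_mul_eq_one_left ?_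
        rw [
          ← qPow_natCast (n := n) hq l, ← qPow_add hq, ← qPow_add hq, ← h,
          ← qPow_zero (n := n) (q := q)]
        congr 1
        push_cast
        ring
      rw [h1, qPow_add hq, qPow_natCast hq]
      have hi := qPow_ne_zero hq i
      have h2 : q ^ (l * l) = q ^ (s * t) * q ^ (l * s) * q ^ ((t + 1).choose 2) * q ^ (t.choose 2) := by
        rw [← pow_add, ← pow_add, ← pow_add]
        congr 1
        have := hch t
        rw [← h]
        nlinarith
      have h3 : qPow q i ^ l = qPow q i ^ s * qPow q i ^ t := by rw [← h, pow_add]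
      rw [h2, h3, mul_pow, ← pow_mul, inv_pow, mul_pow, ← pow_mul]
      field_simp
    simp only [LinearMap.comp_apply, comul_path, map_sum, LinearMap.rTensor_tmul,
      LinearMap.mul'_apply, counit_path]
    rw [Finset.sum_congr rfl key, ← Finset.sum_smul, ← Finset.mul_sum]
    rcases Nat.eq_zero_or_pos l with rfl | hl
    · simp [one_def]
    · have := qBinom_alternating q l hl.ne'
      rw [← Finset.Nat.sum_antidiagonal_swap] at this
      simp only [Prod.fst_swap] at this
      rw [this]
      simp [hl.ne']
  · have key : ∀ x ∈ antidiagonal l, path n q hq (i + x.1) x.2 * S (path n q hq i x.1)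
        = ((-1) ^ x.1 * q ^ (x.1.choose 2) * qBinom q l x.1) • path n q hq 0 l := by
      rintro ⟨s, t⟩ h
      rw [mem_antidiagonal] at h
      simp only at h ⊢
      rw [hS, mul_smul_comm, path_mul_path, smul_smul, qBinom_symm, add_comm t s, h,
        show i + (s : ZMod n) + (-i - (s : ZMod n)) = 0 by ring]
      congr 1
      rw [qPow_add hq, qPow_natCast hq, mul_pow, ← pow_mul, hch, pow_add]
      have hi := qPow_ne_zero hq i
      field_simp
    simp only [LinearMap.comp_apply, comul_path, map_sum, LinearMap.lTensor_tmul,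
      LinearMap.mul'_apply, counit_path]
    rw [Finset.sum_congr rfl key, ← Finset.sum_smul]
    rcases Nat.eq_zero_or_pos l with rfl | hl
    · simp [one_def]
    · rw [qBinom_alternating q l hl.ne']
      simp [hl.ne']

end CyclicHopf

/-! ### Finite-dimensional right comodules -/

/-- A finite-dimensional right comodule over the bialgebra `H`: a finite-dimensional space with a
coaction `ρ : V → V ⊗ H` such that `(ρ ⊗ 1) ρ = (1 ⊗ Δ) ρ` and `(1 ⊗ ε) ρ = 1`. -/
structure FDComodule (k : Type u) (H : Type v) [Field k] [Ring H] [Bialgebra k H] where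
  /-- The underlying space. -/
  carrier : Type u
  [addCommGroup : AddCommGroup carrier]
  [module : Module k carrier]
  [finite : Module.Finite k carrier]
  /-- The coaction. -/
  coact : carrier →ₗ[k] carrier ⊗[k] H
  coassoc : TensorProduct.assoc k carrier H H ∘ₗ coact.rTensor H ∘ₗ coact
    = (Coalgebra.comul (R := k) (A := H)).lTensor carrier ∘ₗ coact
  counit : TensorProduct.rid k carrier ∘ₗ (Coalgebra.counit (R := k) (A := H)).lTensor carrier ∘ₗ
    coact = LinearMap.id

namespace FDComodule

attribute [instance] FDComodule.addCommGroup FDComodule.module FDComodule.finite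

section Basic

variable {k : Type u} {H : Type v} [Field k] [Ring H] [Bialgebra k H]

/-- A linear map between comodules is colinear if it commutes with the coactions. -/
def IsColinear (V W : FDComodule k H) (f : V.carrier →ₗ[k] W.carrier) : Prop :=
  W.coact ∘ₗ f = f.rTensor H ∘ₗ V.coact

/-- Isomorphism of comodules. -/
def Iso (V W : FDComodule k H) : Prop :=
  ∃ e : V.carrier ≃ₗ[k] W.carrier, IsColinear V W e.toLinearMap

/-- There is a split short exact sequence `0 → X → Y → Z → 0` of comodules, that is, there are
colinear maps `i : X → Y`, `p : Y → Z`, a retraction `r` of `i` and a section `s` of `p` with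
`i r + s p = 1`. -/
def SplitExact (X Y Z : FDComodule k H) : Prop :=
  ∃ (i : X.carrier →ₗ[k] Y.carrier) (p : Y.carrier →ₗ[k] Z.carrier)
    (r : Y.carrier →ₗ[k] X.carrier) (s : Z.carrier →ₗ[k] Y.carrier),
    IsColinear X Y i ∧ IsColinear Y Z p ∧ IsColinear Y X r ∧ IsColinear Z Y s ∧
    p ∘ₗ i = 0 ∧ r ∘ₗ i = LinearMap.id ∧ p ∘ₗ s = LinearMap.id ∧
    i ∘ₗ r + s ∘ₗ p = LinearMap.id

section mulTensor

variable (U V : Type*) [AddCommGroup U] [Module k U] [AddCommGroup V] [Module k V]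
  (A : Type*) [Ring A] [Algebra k A]

/-- The map `(U ⊗ A) ⊗ (V ⊗ A) → (U ⊗ V) ⊗ A`, `(u ⊗ a) ⊗ (v ⊗ b) ↦ (u ⊗ v) ⊗ a b`. -/
noncomputable def mulTensor : (U ⊗[k] A) ⊗[k] (V ⊗[k] A) →ₗ[k] (U ⊗[k] V) ⊗[k] A :=
  (LinearMap.mul' k A).lTensor (U ⊗[k] V) ∘ₗ
    (TensorProduct.tensorTensorTensorComm k U A V A).toLinearMap

variable {U V A}

@[simp] theorem mulTensor_tmul (u : U) (v : V) (a b : A) :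
    mulTensor U V A ((u ⊗ₜ[k] a) ⊗ₜ[k] (v ⊗ₜ[k] b)) = (u ⊗ₜ[k] v) ⊗ₜ[k] (a * b) := by
  simp [mulTensor]

theorem tensor_hom_ext {U V A B M : Type*} [AddCommGroup U] [Module k U] [AddCommGroup V]
    [Module k V] [AddCommGroup A] [Module k A] [AddCommGroup B] [Module k B]
    [AddCommGroup M] [Module k M] {f g : (U ⊗[k] A) ⊗[k] (V ⊗[k] B) →ₗ[k] M}
    (h : ∀ u a v b, f ((u ⊗ₜ[k] a) ⊗ₜ[k] (v ⊗ₜ[k] b)) = g ((u ⊗ₜ[k] a) ⊗ₜ[k] (v ⊗ₜ[k] b))) :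
    f = g := by
  ext u a v b
  exact h u a v b

end mulTensor

/-- The tensor product of comodules: `u ⊗ v ↦ u_0 ⊗ v_0 ⊗ u_1 v_1`. -/
noncomputable def tensor (U V : FDComodule k H) : FDComodule k H where
  carrier := U.carrier ⊗[k] V.carrier
  coact := mulTensor U.carrier V.carrier H ∘ₗ TensorProduct.map U.coact V.coact
  coassoc := by
    have hΔ : (Coalgebra.comul (R := k) (A := H)).lTensor (U.carrier ⊗[k] V.carrier) ∘ₗ
          mulTensor U.carrier V.carrier H
        = mulTensor U.carrier V.carrier (H ⊗[k] H) ∘ₗ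
          TensorProduct.map ((Coalgebra.comul (R := k) (A := H)).lTensor U.carrier)
            ((Coalgebra.comul (R := k) (A := H)).lTensor V.carrier) :=
      tensor_hom_ext fun u a v b => by simp
    have hin (a b : H) : (TensorProduct.assoc k (U.carrier ⊗[k] V.carrier) H H).toLinearMap ∘ₗ
          (TensorProduct.mk k _ H).flip (a * b) ∘ₗ mulTensor U.carrier V.carrier H
        = mulTensor U.carrier V.carrier (H ⊗[k] H) ∘ₗ
          TensorProduct.map
            ((TensorProduct.assoc k U.carrier H H).toLinearMap ∘ₗ (TensorProduct.mk k _ H).flip a)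
            ((TensorProduct.assoc k V.carrier H H).toLinearMap ∘ₗ
              (TensorProduct.mk k _ H).flip b) :=
      tensor_hom_ext fun u a v b => by simp
    have hρ : (TensorProduct.assoc k (U.carrier ⊗[k] V.carrier) H H).toLinearMap ∘ₗ
          (mulTensor U.carrier V.carrier H ∘ₗ TensorProduct.map U.coact V.coact).rTensor H ∘ₗ
          mulTensor U.carrier V.carrier H
        = mulTensor U.carrier V.carrier (H ⊗[k] H) ∘ₗ
          TensorProduct.map ((TensorProduct.assoc k U.carrier H H).toLinearMap ∘ₗ U.coact.rTensor H)
            ((TensorProduct.assoc k V.carrier H H).toLinearMap ∘ₗ V.coact.rTensor H) :=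
      tensor_hom_ext fun u a v b => by
        simpa using LinearMap.congr_fun (hin a b) (U.coact u ⊗ₜ[k] V.coact v)
    have hU := U.coassoc
    have hV := V.coassoc
    rw [← LinearMap.comp_assoc] at hU hV
    rw [← LinearMap.comp_assoc (TensorProduct.map U.coact V.coact) _
        ((Coalgebra.comul (R := k) (A := H)).lTensor _), hΔ,
      LinearMap.comp_assoc, ← TensorProduct.map_comp, ← hU, ← hV, TensorProduct.map_comp]
    exact congrArg (fun f => f ∘ₗ TensorProduct.map U.coact V.coact) hρ
  counit := by
    have h : (TensorProduct.rid k (U.carrier ⊗[k] V.carrier)).toLinearMap ∘ₗ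
          (Coalgebra.counit (R := k) (A := H)).lTensor (U.carrier ⊗[k] V.carrier) ∘ₗ
          mulTensor U.carrier V.carrier H
        = TensorProduct.map
          ((TensorProduct.rid k U.carrier).toLinearMap ∘ₗ
            (Coalgebra.counit (R := k) (A := H)).lTensor U.carrier)
          ((TensorProduct.rid k V.carrier).toLinearMap ∘ₗ
            (Coalgebra.counit (R := k) (A := H)).lTensor V.carrier) :=
      tensor_hom_ext fun u a v b => by
        simp [TensorProduct.smul_tmul', smul_smul, mul_comm]
    have hU := U.counit
    have hV := V.counit
    rw [← LinearMap.comp_assoc] at hU hV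
    rw [← LinearMap.comp_assoc (TensorProduct.map U.coact V.coact), ← LinearMap.comp_assoc, h,
      ← TensorProduct.map_comp, hU, hV, TensorProduct.map_id]

/-- The trivial comodule `k`, with coaction `1 ↦ 1 ⊗ 1`. -/
noncomputable def unit : FDComodule k H where
  carrier := k
  coact := (TensorProduct.mk k k H).flip 1
  coassoc := by
    ext
    simp [Algebra.TensorProduct.one_def]
  counit := by
    ext
    simp

theorem Iso.refl (V : FDComodule k H) : Iso V V :=
  ⟨LinearEquiv.refl k _, by ext; simp⟩

theorem IsColinear.comp {U V W : FDComodule k H} {g : V.carrier →ₗ[k] W.carrier}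
    {f : U.carrier →ₗ[k] V.carrier} (hg : IsColinear V W g) (hf : IsColinear U V f) :
    IsColinear U W (g ∘ₗ f) := by
  unfold IsColinear at *
  rw [← LinearMap.comp_assoc, hg, LinearMap.comp_assoc, hf, LinearMap.rTensor_comp,
    LinearMap.comp_assoc]

theorem isColinear_id (V : FDComodule k H) : IsColinear V V LinearMap.id := by
  simp [IsColinear]

theorem Iso.symm {V W : FDComodule k H} (h : Iso V W) : Iso W V := by
  obtain ⟨e, he⟩ := h
  refine ⟨e.symm, ?_⟩
  refine LinearMap.ext fun w => ?_
  obtain ⟨v, rfl⟩ := e.surjective w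
  have h1 := LinearMap.congr_fun he v
  have h2 : e.symm.toLinearMap.rTensor H ∘ₗ e.toLinearMap.rTensor H = LinearMap.id := by
    rw [← LinearMap.rTensor_comp]
    simp
  simp only [LinearMap.comp_apply, LinearEquiv.coe_coe, LinearEquiv.symm_apply_apply] at h1 ⊢
  rw [h1]
  exact (LinearMap.congr_fun h2 (V.coact v)).symm

theorem Iso.trans {U V W : FDComodule k H} (h : Iso U V) (h' : Iso V W) : Iso U W := by
  obtain ⟨e, he⟩ := h
  obtain ⟨e', he'⟩ := h'
  exact ⟨e.trans e', he'.comp he⟩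

theorem IsColinear.tensor {U V U' V' : FDComodule k H} {f : U.carrier →ₗ[k] U'.carrier}
    {g : V.carrier →ₗ[k] V'.carrier} (hf : IsColinear U U' f) (hg : IsColinear V V' g) :
    IsColinear (tensor U V) (tensor U' V') (TensorProduct.map f g) := by
  have h : mulTensor U'.carrier V'.carrier H ∘ₗ TensorProduct.map (f.rTensor H) (g.rTensor H)
      = (TensorProduct.map f g).rTensor H ∘ₗ mulTensor U.carrier V.carrier H :=
    tensor_hom_ext fun u a v b => by simp
  unfold IsColinear at *
  change (mulTensor _ _ H ∘ₗ TensorProduct.map U'.coact V'.coact) ∘ₗ TensorProduct.map f g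
    = (TensorProduct.map f g).rTensor H ∘ₗ mulTensor _ _ H ∘ₗ TensorProduct.map U.coact V.coact
  rw [LinearMap.comp_assoc, ← TensorProduct.map_comp, hf, hg, TensorProduct.map_comp,
    ← LinearMap.comp_assoc, h, LinearMap.comp_assoc]

theorem Iso.tensor {U V U' V' : FDComodule k H} (h : Iso U U') (h' : Iso V V') :
    Iso (tensor U V) (FDComodule.tensor U' V') := by
  obtain ⟨e, he⟩ := h
  obtain ⟨e', he'⟩ := h'
  exact ⟨TensorProduct.congr e e', he.tensor he'⟩

theorem tensor_assoc (U V W : FDComodule k H) :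
    Iso (tensor (tensor U V) W) (tensor U (tensor V W)) := by
  refine ⟨TensorProduct.assoc k U.carrier V.carrier W.carrier, ?_⟩
  have key : mulTensor U.carrier (V.carrier ⊗[k] W.carrier) H ∘ₗ
        (mulTensor V.carrier W.carrier H).lTensor (U.carrier ⊗[k] H) ∘ₗ
        (TensorProduct.assoc k _ _ _).toLinearMap
      = (TensorProduct.assoc k U.carrier V.carrier W.carrier).toLinearMap.rTensor H ∘ₗ
        mulTensor (U.carrier ⊗[k] V.carrier) W.carrier H ∘ₗ
        (mulTensor U.carrier V.carrier H).rTensor (W.carrier ⊗[k] H) := by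
    ext u a v b w c
    simp [mul_assoc]
  refine TensorProduct.ext_threefold fun u v w => ?_
  exact LinearMap.congr_fun key ((U.coact u ⊗ₜ[k] V.coact v) ⊗ₜ[k] W.coact w)

theorem unit_tensor (V : FDComodule k H) : Iso (tensor unit V) V := by
  refine ⟨TensorProduct.lid k V.carrier, ?_⟩
  have key (r : k) : (TensorProduct.lid k V.carrier).toLinearMap.rTensor H ∘ₗ
        mulTensor k V.carrier H ∘ₗ TensorProduct.mk k _ _ (r ⊗ₜ[k] 1) = r • LinearMap.id := by
    ext v a
    simp [TensorProduct.smul_tmul']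
  refine TensorProduct.ext' fun r v => ?_
  have := LinearMap.congr_fun (key r) (V.coact v)
  change V.coact ((show k from r) • v) = _
  rw [map_smul]
  exact this.symm

theorem tensor_unit (V : FDComodule k H) : Iso (tensor V unit) V := by
  refine ⟨TensorProduct.rid k V.carrier, ?_⟩
  have key (r : k) : (TensorProduct.rid k V.carrier).toLinearMap.rTensor H ∘ₗ
        mulTensor V.carrier k H ∘ₗ (TensorProduct.mk k _ _).flip (r ⊗ₜ[k] 1)
        = r • LinearMap.id := by
    ext v a
    simp [TensorProduct.smul_tmul']
  refine TensorProduct.ext' fun v r => ?_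
  have := LinearMap.congr_fun (key r) (V.coact v)
  change V.coact ((show k from r) • v) = _
  rw [map_smul]
  exact this.symm

theorem SplitExact.tensor_left (W : FDComodule k H) {X Y Z : FDComodule k H}
    (h : SplitExact X Y Z) : SplitExact (tensor W X) (tensor W Y) (tensor W Z) := by
  obtain ⟨i, p, r, s, hi, hp, hr, hs, h1, h2, h3, h4⟩ := h
  refine ⟨i.lTensor _, p.lTensor _, r.lTensor _, s.lTensor _, (isColinear_id W).tensor hi,
    (isColinear_id W).tensor hp, (isColinear_id W).tensor hr, (isColinear_id W).tensor hs,
    ?_, ?_, ?_, ?_⟩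
  · exact (LinearMap.lTensor_comp W.carrier p i).symm.trans (by rw [h1]; exact LinearMap.lTensor_zero _)
  · exact (LinearMap.lTensor_comp W.carrier r i).symm.trans (by rw [h2]; exact LinearMap.lTensor_id _ _)
  · exact (LinearMap.lTensor_comp W.carrier p s).symm.trans (by rw [h3]; exact LinearMap.lTensor_id _ _)
  · have := congrArg (LinearMap.lTensor W.carrier) h4
    rw [LinearMap.lTensor_add, LinearMap.lTensor_comp, LinearMap.lTensor_comp,
      LinearMap.lTensor_id] at this
    exact this

theorem SplitExact.tensor_right (W : FDComodule k H) {X Y Z : FDComodule k H}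
    (h : SplitExact X Y Z) : SplitExact (tensor X W) (tensor Y W) (tensor Z W) := by
  obtain ⟨i, p, r, s, hi, hp, hr, hs, h1, h2, h3, h4⟩ := h
  refine ⟨i.rTensor _, p.rTensor _, r.rTensor _, s.rTensor _, hi.tensor (isColinear_id W),
    hp.tensor (isColinear_id W), hr.tensor (isColinear_id W), hs.tensor (isColinear_id W),
    ?_, ?_, ?_, ?_⟩
  · exact (LinearMap.rTensor_comp W.carrier p i).symm.trans (by rw [h1]; exact LinearMap.rTensor_zero _)
  · exact (LinearMap.rTensor_comp W.carrier r i).symm.trans (by rw [h2]; exact LinearMap.rTensor_id _ _)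
  · exact (LinearMap.rTensor_comp W.carrier p s).symm.trans (by rw [h3]; exact LinearMap.rTensor_id _ _)
  · have := congrArg (LinearMap.rTensor W.carrier) h4
    rw [LinearMap.rTensor_add, LinearMap.rTensor_comp, LinearMap.rTensor_comp,
      LinearMap.rTensor_id] at this
    exact this

end Basic

/-! ### The Green ring -/

variable (k : Type u) (H : Type v) [Field k] [Ring H] [Bialgebra k H]

/-- Isomorphism of comodules, as an equivalence relation. -/
instance isoSetoid : Setoid (FDComodule k H) where
  r := Iso
  iseqv := ⟨Iso.refl, Iso.symm, Iso.trans⟩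

/-- The isomorphism classes of finite-dimensional right comodules. -/
def IsoClass : Type _ := Quotient (isoSetoid k H)

variable {k H} in
/-- The isomorphism class of a comodule. -/
def isoClass (V : FDComodule k H) : IsoClass k H := Quotient.mk _ V

/-- Isomorphism classes form a monoid under the tensor product. -/
noncomputable instance : Monoid (IsoClass k H) where
  mul := Quotient.map₂ tensor fun _ _ h _ _ h' => Iso.tensor h h'
  one := isoClass unit
  mul_assoc := by
    rintro ⟨U⟩ ⟨V⟩ ⟨W⟩
    exact Quotient.sound (tensor_assoc U V W)
  one_mul := by
    rintro ⟨U⟩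
    exact Quotient.sound (unit_tensor U)
  mul_one := by
    rintro ⟨U⟩
    exact Quotient.sound (tensor_unit U)

theorem isoClass_mul (U V : FDComodule k H) :
    isoClass U * isoClass V = isoClass (tensor U V) := rfl

/-- The elements `[Y] - [X] - [Z]`, one for each split short exact sequence `0 → X → Y → Z → 0`. -/
def splitRelations : Set (FreeAbelianGroup (IsoClass k H)) :=
  {a | ∃ X Y Z : FDComodule k H, SplitExact X Y Z ∧
    a = .of (isoClass Y) - .of (isoClass X) - .of (isoClass Z)}

theorem mul_mem_closure (x : FreeAbelianGroup (IsoClass k H))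
    {a : FreeAbelianGroup (IsoClass k H)} (ha : a ∈ AddSubgroup.closure (splitRelations k H)) :
    x * a ∈ AddSubgroup.closure (splitRelations k H) := by
  induction x using FreeAbelianGroup.induction_on with
  | zero => simp
  | of W =>
    induction ha using AddSubgroup.closure_induction with
    | mem a h =>
      obtain ⟨X, Y, Z, h, rfl⟩ := h
      obtain ⟨W, rfl⟩ := Quotient.exists_rep W
      refine AddSubgroup.subset_closure ⟨_, _, _, h.tensor_left W, ?_⟩
      simp only [mul_sub]
      rfl
    | zero => simp
    | add a b _ _ ha hb => rw [mul_add]; exact add_mem ha hb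
    | neg a _ ha => rw [mul_neg]; exact neg_mem ha
  | neg W h => rw [neg_mul]; exact neg_mem h
  | add x y hx hy => rw [add_mul]; exact add_mem hx hy

theorem mem_closure_mul (x : FreeAbelianGroup (IsoClass k H))
    {a : FreeAbelianGroup (IsoClass k H)} (ha : a ∈ AddSubgroup.closure (splitRelations k H)) :
    a * x ∈ AddSubgroup.closure (splitRelations k H) := by
  induction x using FreeAbelianGroup.induction_on with
  | zero => simp
  | of W =>
    induction ha using AddSubgroup.closure_induction with
    | mem a h =>
      obtain ⟨X, Y, Z, h, rfl⟩ := h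
      obtain ⟨W, rfl⟩ := Quotient.exists_rep W
      refine AddSubgroup.subset_closure ⟨_, _, _, h.tensor_right W, ?_⟩
      simp only [sub_mul]
      rfl
    | zero => simp
    | add a b _ _ ha hb => rw [add_mul]; exact add_mem ha hb
    | neg a _ ha => rw [neg_mul]; exact neg_mem ha
  | neg W h => rw [mul_neg]; exact neg_mem h
  | add x y hx hy => rw [mul_add]; exact add_mem hx hy

/-- The subgroup generated by the split short exact sequences; it is a two-sided ideal. -/
noncomputable def splitIdeal : Ideal (FreeAbelianGroup (IsoClass k H)) :=
  { AddSubgroup.closure (splitRelations k H) with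
    smul_mem' := fun x _ ha => mul_mem_closure k H x ha }

instance : (splitIdeal k H).IsTwoSided := ⟨fun x ha => mem_closure_mul k H x ha⟩

end FDComodule

/-- The Green ring of the tensor category of finite-dimensional right `H`-comodules: the free
abelian group on the isomorphism classes, modulo the split short exact sequences, with
multiplication given by the tensor product. -/
abbrev GreenRing (k : Type u) (H : Type v) [Field k] [Ring H] [Bialgebra k H] : Type _ :=
  FreeAbelianGroup (FDComodule.IsoClass k H) ⧸ FDComodule.splitIdeal k H

/-- The class `[V]` in the Green ring. -/
noncomputable def GreenRing.of {k : Type u} {H : Type v} [Field k] [Ring H] [Bialgebra k H]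
    (V : FDComodule k H) : GreenRing k H :=
  Ideal.Quotient.mk (FDComodule.splitIdeal k H) (.of V.isoClass)

/-! ### The indecomposable comodules and the ideal of relations -/

namespace CyclicHopf

variable {k : Type u} [Field k] {n : ℕ} [NeZero n] {q : k}

/-- The coaction of `V(i, l)`: `v_m ↦ ∑_{j=m}^{l} v_j ⊗ p_{i+m}^{j-m}`, where `v_m` is the `m`-th
standard basis vector of `k^{l+1}`. -/
noncomputable def vCoact (hq : q ^ n = 1) (i : ZMod n) (l : ℕ) :
    (Fin (l + 1) → k) →ₗ[k] (Fin (l + 1) → k) ⊗[k] CyclicHopf n q hq :=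
  (Pi.basisFun k (Fin (l + 1))).constr k fun m =>
    ∑ j ∈ Finset.Ici m, Pi.single j (1 : k) ⊗ₜ[k] path n q hq (i + (m : ℕ)) (j - m : ℕ)

theorem vCoact_single (hq : q ^ n = 1) (i : ZMod n) (l : ℕ) (m : Fin (l + 1)) :
    vCoact hq i l (Pi.single m 1)
      = ∑ j ∈ Finset.Ici m, Pi.single j (1 : k) ⊗ₜ[k] path n q hq (i + (m : ℕ)) (j - m : ℕ) := by
  rw [vCoact, ← Pi.basisFun_apply, Module.Basis.constr_basis]

/-- The comodule `V(i, l)`, of dimension `l + 1`. -/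
noncomputable def V (hq : q ^ n = 1) (i : ZMod n) (l : ℕ) : FDComodule k (CyclicHopf n q hq) where
  carrier := Fin (l + 1) → k
  coact := vCoact hq i l
  coassoc := by
    refine (Pi.basisFun k (Fin (l + 1))).ext fun m => ?_
    rw [Pi.basisFun_apply]
    simp only [LinearMap.comp_apply, vCoact_single, map_sum, LinearMap.rTensor_tmul,
      LinearMap.lTensor_tmul, TensorProduct.sum_tmul, TensorProduct.tmul_sum,
      LinearEquiv.coe_coe, TensorProduct.assoc_tmul, comul_path]
    rw [Finset.sum_sigma', Finset.sum_sigma']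
    refine Finset.sum_bij' (fun a _ => ⟨a.2, (a.1 - m, a.2 - a.1)⟩)
      (fun a _ => ⟨⟨min (m + a.2.1) l, by omega⟩, a.1⟩) ?_ ?_ ?_ ?_ ?_
    · rintro ⟨a, b⟩ h
      simp only [Finset.mem_sigma, Finset.mem_Ici, Fin.le_def,
        Finset.HasAntidiagonal.mem_antidiagonal] at h ⊢
      omega
    · rintro ⟨a, b⟩ h
      simp only [Finset.mem_sigma, Finset.mem_Ici, Fin.le_def,
        Finset.HasAntidiagonal.mem_antidiagonal] at h ⊢
      omega
    · rintro ⟨a, b⟩ h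
      simp only [Finset.mem_sigma, Finset.mem_Ici, Fin.le_def] at h
      simp only [Sigma.mk.injEq, heq_eq_eq, and_true, Fin.ext_iff]
      omega
    · rintro ⟨a, b, c⟩ h
      simp only [Finset.mem_sigma, Finset.mem_Ici, Fin.le_def,
        Finset.HasAntidiagonal.mem_antidiagonal] at h
      simp only [Sigma.mk.injEq, heq_eq_eq, true_and, Prod.mk.injEq]
      omega
    · rintro ⟨a, b⟩ h
      simp only [Finset.mem_sigma, Finset.mem_Ici, Fin.le_def] at h
      simp only
      rw [add_assoc, ← Nat.cast_add, Nat.add_sub_of_le h.1]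
  counit := by
    refine (Pi.basisFun k (Fin (l + 1))).ext fun m => ?_
    rw [Pi.basisFun_apply]
    simp only [LinearMap.comp_apply, vCoact_single, map_sum, LinearMap.lTensor_tmul,
      LinearEquiv.coe_coe, TensorProduct.rid_tmul, counit_path]
    rw [Finset.sum_eq_single m]
    · simp
    · intro j hj hne
      have : (j : ℕ) - m ≠ 0 := by
        rw [Finset.mem_Ici, Fin.le_def] at hj
        rw [Ne, Fin.ext_iff] at hne
        omega
      simp [this]
    · simp

end CyclicHopf

/-- The polynomial `f_{d-1}(x, y) = ∑_i (-1)^i (d-1-i choose i) x^i y^{d-1-2i}`, for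
`0 ≤ i ≤ ⌊(d-1)/2⌋`, in `ℤ[x, y, z]` with `x = X 0`, `y = X 1`, `z = X 2`. -/
noncomputable def fibPoly (d : ℕ) : MvPolynomial (Fin 3) ℤ :=
  ∑ i ∈ Finset.range ((d - 1) / 2 + 1),
    (-1) ^ i * ((d - 1 - i).choose i : MvPolynomial (Fin 3) ℤ) *
      MvPolynomial.X 0 ^ i * MvPolynomial.X 1 ^ (d - 1 - 2 * i)

/-- The ideal `J` generated by `x^n - 1` and `(y - x - 1) f_{d-1}(x, y)`. -/
noncomputable def relIdeal (n d : ℕ) : Ideal (MvPolynomial (Fin 3) ℤ) :=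
  Ideal.span {MvPolynomial.X 0 ^ n - 1,
    (MvPolynomial.X 1 - MvPolynomial.X 0 - 1) * fibPoly d}

/-! A finite-dimensional comodule over $k\mathcal Z(q)$ is a nilpotent representation of the cyclic
quiver: pairing the coaction with the dual basis of paths gives operators `coef W i l`, which
compose like paths (`coef_coef`). The representation theory is uniserial. If $l$ is the greatest
length of a path acting nontrivially on $W \neq 0$, then some $V(i,l)$ embeds in $W$ and is a direct
summand, because it is injective among comodules on which longer paths act by zero
(`exists_splitExact_of_nontrivial`). Hence the $[V(i,l)]$ span the Green ring.

No uniqueness of decompositions is needed. The rank of `coef W i l` is additive on split sequences,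
so it gives a functional `rankHom` on the Green ring. The Green ring is filtered by the subgroups
`filt L` spanned by the $[V(i,m)]$ with $m<L$; the rank functionals of length $L$ kill `filt L` and
are dual to the $[V(i,L)]$. They prove independence and detect leading terms of products.

The products rest on two computations. First, the longest path acting on $V(i,a)\otimes V(j,b)$ does
so through $\binom{a+b}{a}_q$; if this is nonzero, the product is $[V(i+j,a+b)]$ modulo lower terms
(`of_mul_of_sub_mem_filt`). This applies to multiplication by $y$ when $d\nmid l+1$, where the
binomial is $(l+1)_q$, and to multiplication by $z$ when $d\mid l$, because
$\binom{d(c+1)}{d}_q=c+1$ is nonzero in characteristic $0$. Secondly, $V(0,1)\otimes V(0,l)$ splits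
explicitly: into $V(0,l+1)\oplus V(1,l-1)$ if $l \ge 1$ and $(l+1)_q\ne0$, and into $V(0,l)\oplus
V(1,l)$ if $(l+1)_q=0$. The first splitting is the recurrence of the polynomials $f_a$, so
$f_a\mapsto[V(0,a)]$ for $a<d$; the second, at $l=d-1$, is the relation $(y-x-1)f_{d-1}=0$.

Consequently $x,y,z$ generate the Green ring (`closure_eq_top`), and the relations of $J$ hold in it
(`map_relIdeal`). Modulo $J$ the monomials $x^i f_a z^c$ with $0\le i<n$ and $a<d$ span
(`span_range_relBasis`). The image of such a monomial has leading term $[V(i,dc+a)]$, so the rank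
functionals show that the map is injective (`injective_of_map_X`). -/

/-! ### The coefficients of a comodule -/

namespace FDComodule

section Action

variable {k : Type u} {H : Type v} [Field k] [Ring H] [Bialgebra k H]

/-- The operator `w ↦ ξ(w₁) w₀` on a comodule given by a functional `ξ` on the bialgebra. -/
noncomputable def act (W : FDComodule k H) (ξ : H →ₗ[k] k) : W.carrier →ₗ[k] W.carrier :=
  (TensorProduct.rid k W.carrier).toLinearMap ∘ₗ ξ.lTensor W.carrier ∘ₗ W.coact

/-- Coassociativity: a right comodule is a left module over the convolution algebra dual to the
coalgebra. -/
theorem act_act (W : FDComodule k H) (ξ η : H →ₗ[k] k) :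
    W.act ξ ∘ₗ W.act η
      = W.act (LinearMap.mul' k k ∘ₗ TensorProduct.map ξ η ∘ₗ Coalgebra.comul) := by
  have h1 : (TensorProduct.rid k W.carrier).toLinearMap ∘ₗ
      (LinearMap.mul' k k ∘ₗ TensorProduct.map ξ η).lTensor W.carrier ∘ₗ
        (TensorProduct.assoc k W.carrier H H).toLinearMap
      = (TensorProduct.rid k W.carrier).toLinearMap ∘ₗ ξ.lTensor W.carrier ∘ₗ
        (TensorProduct.rid k (W.carrier ⊗[k] H)).toLinearMap ∘ₗ η.lTensor _ := by
    ext w a b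
    simp [smul_smul, mul_comm]
  have h2 : (TensorProduct.rid k (W.carrier ⊗[k] H)).toLinearMap ∘ₗ η.lTensor _ ∘ₗ
      W.coact.rTensor H
      = W.coact ∘ₗ (TensorProduct.rid k W.carrier).toLinearMap ∘ₗ η.lTensor W.carrier := by
    ext w a
    simp
  refine LinearMap.ext fun w => ?_
  have h := LinearMap.congr_fun W.coassoc w
  have h1' := LinearMap.congr_fun h1 (W.coact.rTensor H (W.coact w))
  have h2' := LinearMap.congr_fun h2 (W.coact w)
  simp only [LinearMap.comp_apply, LinearEquiv.coe_coe] at h h1' h2'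
  simp only [act, LinearMap.comp_apply, LinearEquiv.coe_coe]
  rw [← h2', ← h1', h]
  simp only [LinearMap.lTensor_comp_apply]

theorem IsColinear.act {V W : FDComodule k H} {f : V.carrier →ₗ[k] W.carrier}
    (hf : IsColinear V W f) (ξ : H →ₗ[k] k) (v : V.carrier) :
    W.act ξ (f v) = f (V.act ξ v) := by
  have h2 : (TensorProduct.rid k W.carrier).toLinearMap ∘ₗ ξ.lTensor W.carrier ∘ₗ f.rTensor H
      = f ∘ₗ (TensorProduct.rid k V.carrier).toLinearMap ∘ₗ ξ.lTensor V.carrier := by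
    ext w a
    simp
  have h := LinearMap.congr_fun hf v
  have h2' := LinearMap.congr_fun h2 (V.coact v)
  simp only [LinearMap.comp_apply, LinearEquiv.coe_coe] at h h2'
  simp only [FDComodule.act, LinearMap.comp_apply, LinearEquiv.coe_coe]
  rw [h, h2']

/-- A colinear retraction `r` of a colinear map `i` gives a split exact sequence. -/
theorem exists_splitExact {X W : FDComodule k H} {i : X.carrier →ₗ[k] W.carrier}
    {r : W.carrier →ₗ[k] X.carrier} (hi : IsColinear X W i) (hr : IsColinear W X r)
    (hri : r ∘ₗ i = LinearMap.id) :
    ∃ Z : FDComodule k H, SplitExact X W Z := by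
  let ι : LinearMap.ker r →ₗ[k] W.carrier := (LinearMap.ker r).subtype
  let p : W.carrier →ₗ[k] LinearMap.ker r :=
    (LinearMap.id - i ∘ₗ r).codRestrict _ fun w => by
      have := LinearMap.congr_fun hri (r w)
      simp only [LinearMap.comp_apply, LinearMap.id_apply] at this
      simp [this]
  have hιp : ι ∘ₗ p = LinearMap.id - i ∘ₗ r := by ext; rfl
  have hpι : p ∘ₗ ι = LinearMap.id := by
    ext ⟨w, hw⟩
    have : r w = 0 := hw
    simp [p, ι, this]
  have hpi : p ∘ₗ i = 0 := by
    ext w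
    have := LinearMap.congr_fun hri w
    simp only [LinearMap.comp_apply, LinearMap.id_apply] at this
    simp [p, this]
  have hrι : r ∘ₗ ι = 0 := by ext ⟨w, hw⟩; exact hw
  -- The idempotent $\iota p = 1 - ir$ is colinear, being a difference of colinear maps.
  have he : W.coact ∘ₗ (ι ∘ₗ p) = (ι ∘ₗ p).rTensor H ∘ₗ W.coact := by
    have := hi.comp hr
    rw [IsColinear] at this
    rw [hιp, LinearMap.comp_sub, this, LinearMap.rTensor_sub, LinearMap.sub_comp]
    simp
  -- The coaction of $W$ preserves $\ker r$; it is brought back to $\ker r\otimes H$ by applying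
  -- $p$, which is the identity on $\ker r$.
  let ρ := p.rTensor H ∘ₗ W.coact ∘ₗ ι
  have hι : W.coact ∘ₗ ι = ι.rTensor H ∘ₗ ρ := by
    calc W.coact ∘ₗ ι = (W.coact ∘ₗ (ι ∘ₗ p)) ∘ₗ ι := by
          rw [LinearMap.comp_assoc, LinearMap.comp_assoc, hpι, LinearMap.comp_id]
      _ = _ := by rw [he, LinearMap.rTensor_comp]; rfl
  let Z : FDComodule k H :=
    { carrier := LinearMap.ker r
      coact := ρ
      coassoc := by
        have h1 : (TensorProduct.assoc k (LinearMap.ker r) H H).toLinearMap ∘ₗ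
            (p.rTensor H).rTensor H
            = p.rTensor (H ⊗[k] H) ∘ₗ (TensorProduct.assoc k W.carrier H H).toLinearMap := by
          ext; simp
        have h2 : ρ.rTensor H ∘ₗ ρ
            = (p.rTensor H).rTensor H ∘ₗ W.coact.rTensor H ∘ₗ W.coact ∘ₗ ι := by
          rw [hι]
          simp only [ρ, LinearMap.rTensor_comp, LinearMap.comp_assoc]
        have h3 : (Coalgebra.comul (R := k) (A := H)).lTensor (LinearMap.ker r) ∘ₗ p.rTensor H
            = p.rTensor (H ⊗[k] H) ∘ₗ (Coalgebra.comul (R := k) (A := H)).lTensor W.carrier := by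
          ext; simp
        have h := W.coassoc
        rw [h2, ← LinearMap.comp_assoc, h1]
        change _ = LinearMap.lTensor _ _ ∘ₗ (p.rTensor H ∘ₗ W.coact ∘ₗ ι)
        rw [← LinearMap.comp_assoc _ _ (LinearMap.lTensor _ _), h3, LinearMap.comp_assoc,
          LinearMap.comp_assoc]
        congr 1
        have := congrArg (· ∘ₗ ι) h
        simpa only [LinearMap.comp_assoc] using this
      counit := by
        have h3 : (TensorProduct.rid k (LinearMap.ker r)).toLinearMap ∘ₗ
            (Coalgebra.counit (R := k) (A := H)).lTensor (LinearMap.ker r) ∘ₗ p.rTensor H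
            = p ∘ₗ (TensorProduct.rid k W.carrier).toLinearMap ∘ₗ
              (Coalgebra.counit (R := k) (A := H)).lTensor W.carrier := by
          ext; simp
        have h := W.counit
        refine LinearMap.ext fun z => ?_
        have h3' := LinearMap.congr_fun h3 (W.coact (ι z))
        have h' := LinearMap.congr_fun h (ι z)
        simp only [LinearMap.comp_apply, LinearEquiv.coe_coe] at h3' h'
        change (TensorProduct.rid k (LinearMap.ker r)) _ = _
        simp only [ρ, LinearMap.comp_apply]
        rw [h3', h']
        exact LinearMap.congr_fun hpι z }
  refine ⟨Z, i, p, r, ι, hi, ?_, hr, hι, hpi, hri, hpι, ?_⟩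
  · change ρ ∘ₗ p = _
    calc ρ ∘ₗ p = p.rTensor H ∘ₗ (W.coact ∘ₗ (ι ∘ₗ p)) := by simp only [ρ, LinearMap.comp_assoc]
      _ = _ := by
        rw [he, ← LinearMap.comp_assoc, ← LinearMap.rTensor_comp, ← LinearMap.comp_assoc, hpι,
          LinearMap.id_comp]
  · rw [hιp]; abel

/-- Two colinear maps which together give a linear isomorphism `X × Z → W`. -/
theorem splitExact_of_bijective {X W Z : FDComodule k H} {i : X.carrier →ₗ[k] W.carrier}
    {s : Z.carrier →ₗ[k] W.carrier} (hi : IsColinear X W i) (hs : IsColinear Z W s)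
    (h : Function.Bijective (i.coprod s)) : SplitExact X W Z := by
  let e := LinearEquiv.ofBijective _ h
  have he (x : X.carrier) (z : Z.carrier) : e (x, z) = i x + s z := by simp [e]
  have he1 (x : X.carrier) : e.symm (i x) = (x, 0) := by
    rw [LinearEquiv.symm_apply_eq, he]; simp
  have he2 (z : Z.carrier) : e.symm (s z) = (0, z) := by
    rw [LinearEquiv.symm_apply_eq, he]; simp
  let r := LinearMap.fst k _ _ ∘ₗ e.symm.toLinearMap
  let p := LinearMap.snd k _ _ ∘ₗ e.symm.toLinearMap
  have hri : r ∘ₗ i = LinearMap.id := by ext x; simp [r, he1]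
  have hrs : r ∘ₗ s = 0 := by ext x; simp [r, he2]
  have hpi : p ∘ₗ i = 0 := by ext x; simp [p, he1]
  have hps : p ∘ₗ s = LinearMap.id := by ext x; simp [p, he2]
  have hsum : i ∘ₗ r + s ∘ₗ p = LinearMap.id := by
    ext w
    simp only [r, p, LinearMap.add_apply, LinearMap.comp_apply, LinearMap.id_apply,
      LinearEquiv.coe_coe, LinearMap.fst_apply, LinearMap.snd_apply]
    rw [← he]
    simp
  unfold IsColinear at hi hs
  -- Maps out of $W$ are determined on the images of $i$ and $s$, so colinearity of $p$ and $r$ need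
  -- only be checked there.
  have ext' {M : Type _} [AddCommGroup M] [Module k M] {f g : W.carrier →ₗ[k] M}
      (h1 : f ∘ₗ i = g ∘ₗ i) (h2 : f ∘ₗ s = g ∘ₗ s) : f = g := by
    refine LinearMap.ext fun w => ?_
    have hw := LinearMap.congr_fun hsum w
    simp only [LinearMap.add_apply, LinearMap.comp_apply, LinearMap.id_apply] at hw
    have e1 := LinearMap.congr_fun h1 (r w)
    have e2 := LinearMap.congr_fun h2 (p w)
    simp only [LinearMap.comp_apply] at e1 e2
    rw [← hw, map_add, map_add, e1, e2]
  refine ⟨i, p, r, s, hi, ext' ?_ ?_, ext' ?_ ?_, hs, hpi, hri, hps, hsum⟩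
  · rw [LinearMap.comp_assoc, hpi, LinearMap.comp_assoc, hi, ← LinearMap.comp_assoc,
      ← LinearMap.rTensor_comp, hpi]
    simp
  · rw [LinearMap.comp_assoc, hps, LinearMap.comp_assoc, hs, ← LinearMap.comp_assoc,
      ← LinearMap.rTensor_comp, hps]
    simp
  · rw [LinearMap.comp_assoc, hri, LinearMap.comp_assoc, hi, ← LinearMap.comp_assoc,
      ← LinearMap.rTensor_comp, hri]
    simp
  · rw [LinearMap.comp_assoc, hrs, LinearMap.comp_assoc, hs, ← LinearMap.comp_assoc,
      ← LinearMap.rTensor_comp, hrs]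
    simp

end Action

end FDComodule

/-! ### Calculus in the Green ring -/

namespace GreenRing

open FDComodule

variable {k : Type u} {H : Type v} [Field k] [Ring H] [Bialgebra k H]

theorem of_mul (U W : FDComodule k H) : of U * of W = of (tensor U W) := by
  rw [of, of, of, ← map_mul, ← FreeAbelianGroup.of_mul, isoClass_mul]

theorem of_congr {U W : FDComodule k H} (h : Iso U W) : of U = of W := by
  rw [of, of, isoClass, isoClass, Quotient.sound h]

theorem of_splitExact {X Y Z : FDComodule k H} (h : SplitExact X Y Z) : of Y = of X + of Z := by
  have : (FreeAbelianGroup.of Y.isoClass - .of X.isoClass - .of Z.isoClass) ∈ splitIdeal k H :=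
    AddSubgroup.subset_closure ⟨X, Y, Z, h, rfl⟩
  rw [of, of, of, ← map_add, Ideal.Quotient.eq, ← sub_sub]
  exact this

theorem induction_on {P : GreenRing k H → Prop} (x : GreenRing k H)
    (of : ∀ W, P (of W)) (neg : ∀ x, P x → P (-x)) (add : ∀ x y, P x → P y → P (x + y)) :
    P x := by
  obtain ⟨x, rfl⟩ := Ideal.Quotient.mk_surjective x
  have ho (W) : P (Ideal.Quotient.mk _ (FreeAbelianGroup.of W)) := by
    obtain ⟨W, rfl⟩ := Quotient.exists_rep W
    exact of W
  induction x using FreeAbelianGroup.induction_on with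
  | zero =>
    -- Zero is not among the cases; it is reached as $[k]-[k]$.
    have := add _ _ (of unit) (neg _ (of unit))
    rwa [add_neg_cancel, ← map_zero (Ideal.Quotient.mk (splitIdeal k H))] at this
  | of W => exact ho W
  | neg W h => rw [map_neg]; exact neg _ h
  | add x y hx hy => rw [map_add]; exact add _ _ hx hy

/-- An additive invariant of comodules extends to the Green ring. -/
theorem exists_addMonoidHom {A : Type*} [AddCommGroup A] (f : FDComodule k H → A)
    (hiso : ∀ U W, Iso U W → f U = f W)
    (hadd : ∀ X Y Z, SplitExact X Y Z → f Y = f X + f Z) :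
    ∃ F : GreenRing k H →+ A, ∀ W, F (of W) = f W := by
  let g : FreeAbelianGroup (IsoClass k H) →+ A :=
    FreeAbelianGroup.lift (Quotient.lift f hiso)
  have hg : ∀ a ∈ splitIdeal k H, g a = 0 := by
    intro a ha
    have : AddSubgroup.closure (splitRelations k H) ≤ g.ker := by
      rw [AddSubgroup.closure_le]
      rintro _ ⟨X, Y, Z, h, rfl⟩
      have := hadd X Y Z h
      have e (W : FDComodule k H) : g (.of W.isoClass) = f W := FreeAbelianGroup.lift_apply_of _ _
      simp only [SetLike.mem_coe, AddMonoidHom.mem_ker, map_sub, e, this]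
      abel
    exact this ha
  refine ⟨QuotientAddGroup.lift (splitIdeal k H).toAddSubgroup g hg, fun W => ?_⟩
  exact FreeAbelianGroup.lift_apply_of _ _

end GreenRing

/-! ### Comodules over `k𝒵(q)` as representations of the cyclic quiver -/

namespace CyclicHopf

open FDComodule Finset.HasAntidiagonal

variable {k : Type u} [Field k] {n : ℕ} [NeZero n] {q : k} {hq : q ^ n = 1}

theorem coord_path (i j : ZMod n) (l m : ℕ) :
    (pathBasis n q hq).coord (i, l) (path n q hq j m) = if j = i ∧ m = l then 1 else 0 := by
  rw [path, Module.Basis.coord_apply, Module.Basis.repr_self, Finsupp.single_apply]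
  simp

/-- A path $p_i^{l}$ can be cut after $s$ steps in one way only, into $p_{i+s}^{l-s}\otimes p_i^s$.
The dual basis therefore multiplies like the paths of the quiver, with $0$ for paths that do not
meet. -/
theorem coord_conv (i j : ZMod n) (s t : ℕ) :
    LinearMap.mul' k k ∘ₗ TensorProduct.map ((pathBasis n q hq).coord (j, t))
        ((pathBasis n q hq).coord (i, s)) ∘ₗ Coalgebra.comul
      = if j = i + s then (pathBasis n q hq).coord (i, s + t) else 0 := by
  refine hom_ext fun a l => ?_
  have hR : (if j = i + s then (pathBasis n q hq).coord (i, s + t) else 0) (path n q hq a l)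
      = if j = i + s ∧ a = i ∧ l = s + t then 1 else 0 := by
    by_cases hj : j = i + s
    · rw [if_pos hj, coord_path]
      simp [hj]
    · simp [hj]
  simp only [hR, LinearMap.comp_apply, comul_path, map_sum, TensorProduct.map_tmul,
    LinearMap.mul'_apply, coord_path]
  by_cases hl : l = s + t
  · subst hl
    rw [Finset.sum_eq_single (s, t)]
    · by_cases ha : a = i
      · simp [ha, eq_comm]
      · simp [ha]
    · rintro ⟨b, c⟩ _ hne
      by_cases hb : b = s
      · have hc : c ≠ t := by rintro rfl; exact hne (by rw [hb])
        simp [hc]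
      · simp [hb]
    · simp
  · rw [Finset.sum_eq_zero]
    · simp [hl]
    · rintro ⟨b, c⟩ hbc
      rw [mem_antidiagonal] at hbc
      simp only at hbc ⊢
      by_cases hb : b = s
      · have hc : c ≠ t := by rintro rfl; exact hl (by rw [← hbc, hb])
        simp [hc]
      · simp [hb]

/-- The coefficient of the path `p_i^l` in the coaction of a comodule. -/
noncomputable def coef (W : FDComodule k (CyclicHopf n q hq)) (i : ZMod n) (l : ℕ) :
    W.carrier →ₗ[k] W.carrier :=
  W.act ((pathBasis n q hq).coord (i, l))

variable {W U : FDComodule k (CyclicHopf n q hq)}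

/-- The path algebra of the cyclic quiver acts: after following $p_i^s$ one stands at the vertex
$i+s$, and only paths that start there act nontrivially. -/
theorem coef_coef (i j : ZMod n) (s t : ℕ) (w : W.carrier) :
    coef W j t (coef W i s w) = if j = i + s then coef W i (s + t) w else 0 := by
  have := LinearMap.congr_fun (act_act W ((pathBasis n q hq).coord (j, t))
    ((pathBasis n q hq).coord (i, s))) w
  rw [coord_conv] at this
  rw [coef, coef, ← LinearMap.comp_apply, this]
  split_ifs with h
  · rfl
  · simp [act]

theorem coef_coef_self (i : ZMod n) (s t : ℕ) (w : W.carrier) :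
    coef W (i + s) t (coef W i s w) = coef W i (s + t) w := by
  rw [coef_coef, if_pos rfl]

/-- The counit is the sum of the coordinates of the trivial paths. With `coef_coef` this makes the
operators `coef W i 0` a complete system of orthogonal idempotents, which grades $W$ by the
vertices. -/
theorem sum_coef_zero (w : W.carrier) : ∑ i : ZMod n, coef W i 0 w = w := by
  have h : Coalgebra.counit (R := k) (A := CyclicHopf n q hq)
      = ∑ i : ZMod n, (pathBasis n q hq).coord (i, 0) := hom_ext fun i l => by
    rw [counit_path, LinearMap.sum_apply]
    simp only [coord_path]
    rw [Finset.sum_eq_single i] <;> simp +contextual [eq_comm]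
  have hw := LinearMap.congr_fun W.counit w
  rw [h] at hw
  simp only [LinearMap.comp_apply, LinearMap.id_apply, LinearEquiv.coe_coe] at hw
  conv_rhs => rw [← hw]
  have hl : (∑ i : ZMod n, (pathBasis n q hq).coord (i, 0)).lTensor W.carrier
      = ∑ i : ZMod n, ((pathBasis n q hq).coord (i, 0)).lTensor W.carrier :=
    map_sum (LinearMap.lTensorHom (R := k) W.carrier) _ _
  rw [hl, LinearMap.sum_apply, map_sum]
  rfl

theorem coef_eq_repr (i : ZMod n) (l : ℕ) (w : W.carrier) :
    coef W i l w
      = TensorProduct.equivFinsuppOfBasisRight (pathBasis n q hq) (W.coact w) (i, l) := by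
  rw [TensorProduct.equivFinsuppOfBasisRight_apply]
  rfl

theorem tensor_ext {M : Type*} [AddCommGroup M] [Module k M] {x y : M ⊗[k] CyclicHopf n q hq}
    (h : ∀ i l, TensorProduct.rid k M (((pathBasis n q hq).coord (i, l)).lTensor M x)
      = TensorProduct.rid k M (((pathBasis n q hq).coord (i, l)).lTensor M y)) : x = y := by
  refine (TensorProduct.equivFinsuppOfBasisRight (pathBasis n q hq)).injective ?_
  ext ⟨i, l⟩
  rw [TensorProduct.equivFinsuppOfBasisRight_apply, TensorProduct.equivFinsuppOfBasisRight_apply, h]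

variable (W) in
-- The coaction of one vector involves finitely many paths, and a finite basis makes the bound
-- uniform. This is the nilpotency of the representation.
theorem exists_coef_eq_zero : ∃ N : ℕ, ∀ i l, N ≤ l → coef W i l = 0 := by
  have h1 (w : W.carrier) : ∃ N : ℕ, ∀ i l, N ≤ l → coef W i l w = 0 := by
    let s := (TensorProduct.equivFinsuppOfBasisRight (pathBasis n q hq) (W.coact w)).support
    refine ⟨s.sup Prod.snd + 1, fun i l hl => ?_⟩
    by_contra hne
    rw [coef_eq_repr, ← Ne, ← Finsupp.mem_support_iff] at hne
    have := Finset.le_sup (f := Prod.snd) hne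
    exact absurd (hl.trans this) (Nat.not_succ_le_self _)
  choose N hN using h1
  let b := Module.finBasis k W.carrier
  refine ⟨Finset.univ.sup fun j => N (b j), fun i l hl => b.ext fun j => ?_⟩
  exact hN _ i l ((Finset.le_sup (f := fun j => N (b j)) (Finset.mem_univ j)).trans hl)

/-- The coordinates of the paths separate the elements of $U\otimes H$, so a linear map is colinear
exactly when it is a map of quiver representations. -/
theorem isColinear_iff {f : W.carrier →ₗ[k] U.carrier} :
    IsColinear W U f ↔ ∀ i l w, coef U i l (f w) = f (coef W i l w) := by
  refine ⟨fun h i l w => h.act _ w, fun h => LinearMap.ext fun w => tensor_ext fun i l => ?_⟩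
  have h2 (ξ : CyclicHopf n q hq →ₗ[k] k) : (TensorProduct.rid k U.carrier).toLinearMap ∘ₗ
      ξ.lTensor U.carrier ∘ₗ f.rTensor _
      = f ∘ₗ (TensorProduct.rid k W.carrier).toLinearMap ∘ₗ ξ.lTensor W.carrier := by
    ext w a
    simp
  have h3 := LinearMap.congr_fun (h2 ((pathBasis n q hq).coord (i, l))) (W.coact w)
  exact (h i l w).trans h3.symm

theorem coef_of_homogeneous {i : ZMod n} {w : W.carrier} (hw : coef W i 0 w = w) (j : ZMod n)
    (l : ℕ) : coef W j l w = if j = i then coef W i l w else 0 := by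
  conv_lhs => rw [← hw, coef_coef]
  simp

theorem coact_of_homogeneous {i : ZMod n} {w : W.carrier} (hw : coef W i 0 w = w) {N : ℕ}
    (hN : ∀ l, N ≤ l → coef W i l w = 0) :
    W.coact w = ∑ s ∈ Finset.range N, coef W i s w ⊗ₜ[k] path n q hq i s := by
  refine tensor_ext fun j l => ?_
  change coef W j l w = _
  simp only [map_sum, LinearMap.lTensor_tmul, coord_path, TensorProduct.rid_tmul]
  rw [coef_of_homogeneous hw]
  by_cases hj : j = i
  · subst hj
    by_cases hl : l < N
    · rw [Finset.sum_eq_single l] <;> simp +contextual [hl]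
    · rw [Finset.sum_eq_zero]
      · simp [hN l (by omega)]
      · intro s hs
        have : s ≠ l := by rw [Finset.mem_range] at hs; omega
        simp [this]
  · simp [hj, Ne.symm hj]

/-- The tensor `x ⊗ w`, as an element of the tensor product of comodules. -/
def tmul (x : U.carrier) (w : W.carrier) : (tensor U W).carrier := x ⊗ₜ[k] w

/-- The coefficients of a tensor product. -/
theorem coef_tensor {i j : ZMod n} {x : U.carrier} {w : W.carrier} (hx : coef U i 0 x = x)
    (hw : coef W j 0 w = w) (m : ZMod n) (l : ℕ) :
    coef (tensor U W) m l (tmul x w) = if m = i + j then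
      ∑ y ∈ antidiagonal l, (qPow q i ^ y.2 * qBinom q l y.1) •
        tmul (coef U i y.1 x) (coef W j y.2 w) else 0 := by
  obtain ⟨N₁, h₁⟩ := exists_coef_eq_zero U
  obtain ⟨N₂, h₂⟩ := exists_coef_eq_zero W
  -- Large enough for both coactions to be summed up to $N$, and for every pair with $s+t=l$ to lie
  -- in the square of indices.
  let N := N₁ + N₂ + l + 1
  have e : coef (tensor U W) m l (x ⊗ₜ[k] w)
      = ∑ s ∈ Finset.range N, ∑ t ∈ Finset.range N, if i + j = m ∧ s + t = l then
        (qPow q i ^ t * qBinom q (s + t) s) • (coef U i s x ⊗ₜ[k] coef W j t w) else 0 := by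
    change TensorProduct.rid k (U.carrier ⊗[k] W.carrier)
      (LinearMap.lTensor _ _ (mulTensor _ _ _ (U.coact x ⊗ₜ[k] W.coact w))) = _
    rw [coact_of_homogeneous (N := N) hx fun l hl => by rw [h₁ i l (by omega)]; rfl,
      coact_of_homogeneous (N := N) hw fun l hl => by rw [h₂ j l (by omega)]; rfl]
    simp only [TensorProduct.sum_tmul, TensorProduct.tmul_sum, map_sum, mulTensor_tmul,
      LinearMap.lTensor_tmul, TensorProduct.rid_tmul, path_mul_path, map_smul, coord_path,
      smul_eq_mul, mul_ite, mul_one, mul_zero, ite_smul, zero_smul]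
    rw [Finset.sum_comm]
  refine Eq.trans (b := if m = i + j then
      ∑ y ∈ antidiagonal l, (qPow q i ^ y.2 * qBinom q l y.1) •
        (coef U i y.1 x ⊗ₜ[k] coef W j y.2 w) else 0) (e.trans ?_) rfl
  by_cases hm : i + j = m
  · rw [if_pos hm.symm, ← Finset.sum_product', ← Finset.sum_filter]
    refine Finset.sum_congr ?_ ?_
    · ext ⟨s, t⟩
      simp only [Finset.mem_filter, Finset.mem_product, Finset.mem_range, mem_antidiagonal]
      refine ⟨fun h => h.2.2, fun h => ⟨?_, hm, h⟩⟩
      omega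
    · rintro ⟨s, t⟩ h
      rw [mem_antidiagonal] at h
      simp only at h ⊢
      rw [h]
  · rw [if_neg (Ne.symm hm)]
    simp only [hm, false_and, if_false, Finset.sum_const_zero]
    rfl

end CyclicHopf

namespace CyclicHopf

open FDComodule Finset.HasAntidiagonal

variable {k : Type u} [Field k] {n : ℕ} [NeZero n] {q : k} {hq : q ^ n = 1}

/-! ### The comodules `V(i, l)` -/

variable (hq) in
/-- The basis vector `v_m` of `V(i, l)`, with `v_m = 0` for `m > l`. -/
noncomputable def vec (i : ZMod n) (l m : ℕ) : (V hq i l).carrier :=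
  if h : m < l + 1 then (Pi.single ⟨m, h⟩ 1 : Fin (l + 1) → k) else (0 : Fin (l + 1) → k)

variable (hq) in
/-- The `m`-th coordinate on `V(i, l)`, with the convention that it vanishes for `m > l`. -/
noncomputable def vCoord (i : ZMod n) (l m : ℕ) : (V hq i l).carrier →ₗ[k] k :=
  if h : m < l + 1 then (LinearMap.proj (⟨m, h⟩ : Fin (l + 1)) : (Fin (l + 1) → k) →ₗ[k] k)
  else (0 : (Fin (l + 1) → k) →ₗ[k] k)

theorem vec_of_lt (i : ZMod n) {l m : ℕ} (h : m < l + 1) :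
    vec hq i l m = (Pi.single ⟨m, h⟩ 1 : Fin (l + 1) → k) :=
  dif_pos h

theorem vec_eq_zero {i : ZMod n} {l m : ℕ} (h : l < m) : vec hq i l m = 0 :=
  dif_neg (by omega)

theorem vCoord_of_lt (i : ZMod n) {l m : ℕ} (h : m < l + 1) :
    vCoord hq i l m = (LinearMap.proj (⟨m, h⟩ : Fin (l + 1)) : (Fin (l + 1) → k) →ₗ[k] k) :=
  dif_pos h

theorem vCoord_eq_zero {i : ZMod n} {l m : ℕ} (h : l < m) : vCoord hq i l m = 0 :=
  dif_neg (by omega)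

theorem vCoord_vec (i : ZMod n) (l a m : ℕ) :
    vCoord hq i l a (vec hq i l m) = if a = m ∧ m ≤ l then 1 else 0 := by
  by_cases hm : m ≤ l
  · by_cases ha : a ≤ l
    · rw [vec_of_lt i (Nat.lt_succ_of_le hm), vCoord_of_lt i (Nat.lt_succ_of_le ha)]
      change (Pi.single (⟨m, _⟩ : Fin (l + 1)) (1 : k) : Fin (l + 1) → k) ⟨a, _⟩ = _
      rw [Pi.single_apply]
      simp [hm, Fin.ext_iff]
    · rw [vCoord_eq_zero (by omega), if_neg (by omega)]
      rfl
  · rw [vec_eq_zero (by omega), map_zero, if_neg (by omega)]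

theorem vHom_ext {i : ZMod n} {l : ℕ} {M : Type*} [AddCommGroup M] [Module k M]
    {f g : (V hq i l).carrier →ₗ[k] M} (h : ∀ m ≤ l, f (vec hq i l m) = g (vec hq i l m)) :
    f = g := by
  refine (Pi.basisFun k (Fin (l + 1))).ext fun m => ?_
  have := h m (by omega)
  rw [vec_of_lt i m.2] at this
  rw [Pi.basisFun_apply]
  exact this

theorem vCoord_ext {i : ZMod n} {l : ℕ} {x y : (V hq i l).carrier}
    (h : ∀ a ≤ l, vCoord hq i l a x = vCoord hq i l a y) : x = y := by
  refine funext (fun a : Fin (l + 1) => ?_)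
  have := h a (by omega)
  rw [vCoord_of_lt i a.2] at this
  exact this

theorem finrank_V (i : ZMod n) (l : ℕ) : Module.finrank k (V hq i l).carrier = l + 1 := by
  change Module.finrank k (Fin (l + 1) → k) = _
  simp

theorem coef_vec (i j : ZMod n) (l s m : ℕ) :
    coef (V hq i l) j s (vec hq i l m) = if j = i + m then vec hq i l (m + s) else 0 := by
  by_cases hm : m < l + 1
  · have e : vec hq i l m = (Pi.single ⟨m, hm⟩ 1 : Fin (l + 1) → k) := vec_of_lt i hm
    have h : coef (V hq i l) j s (vec hq i l m)
        = TensorProduct.rid k (Fin (l + 1) → k) (LinearMap.lTensor _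
          ((pathBasis n q hq).coord (j, s)) (vCoact hq i l (Pi.single ⟨m, hm⟩ 1))) := by rw [e]; rfl
    rw [h, vCoact_single]
    simp only [map_sum, LinearMap.lTensor_tmul, coord_path, TensorProduct.rid_tmul]
    by_cases hj : j = i + m
    · rw [if_pos hj]
      by_cases hs : m + s < l + 1
      · rw [Finset.sum_eq_single ⟨m + s, hs⟩, vec_of_lt i hs]
        · simp [hj]
          rfl
        · rintro ⟨b, hb⟩ hmem hne
          rw [Finset.mem_Ici, Fin.mk_le_mk] at hmem
          rw [if_neg, zero_smul]
          rintro ⟨-, rfl⟩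
          exact hne (by simp; omega)
        · intro h
          exact absurd (Finset.mem_Ici.2 (Fin.mk_le_mk.2 (by omega))) h
      · rw [vec_eq_zero (by omega), Finset.sum_eq_zero]
        · rfl
        · rintro ⟨b, hb⟩ hmem
          rw [Finset.mem_Ici, Fin.mk_le_mk] at hmem
          rw [if_neg, zero_smul]
          rintro ⟨-, h⟩
          simp only at h
          omega
    · simp only [Ne.symm hj, false_and, if_false, zero_smul, Finset.sum_const_zero, if_neg hj]
      rfl
  · rw [vec_eq_zero (m := m) (by omega), vec_eq_zero (by omega)]
    simp

/-- The transpose of `coef_vec`. The condition $t\le a$ guards the truncated subtraction. -/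
theorem vCoord_coef (i j : ZMod n) (l t : ℕ) {a : ℕ} (ha : a ≤ l) (x : (V hq i l).carrier) :
    vCoord hq i l a (coef (V hq i l) j t x)
      = if t ≤ a ∧ j + t = i + a then vCoord hq i l (a - t) x else 0 := by
  have : vCoord hq i l a ∘ₗ coef (V hq i l) j t
      = if t ≤ a ∧ j + t = i + a then vCoord hq i l (a - t) else 0 := by
    refine vHom_ext fun m hm => ?_
    rw [LinearMap.comp_apply, coef_vec]
    have h2 : (if t ≤ a ∧ j + t = i + a then vCoord hq i l (a - t) else 0) (vec hq i l m)
        = if (t ≤ a ∧ j + t = i + a) ∧ a - t = m then 1 else 0 := by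
      by_cases h : t ≤ a ∧ j + t = i + a
      · rw [if_pos h, vCoord_vec]
        simp [h, hm]
      · rw [if_neg h, if_neg fun h' => h h'.1]
        rfl
    rw [h2]
    by_cases hj : j = i + m
    · rw [if_pos hj, vCoord_vec]
      refine if_congr ⟨?_, ?_⟩ rfl rfl
      · rintro ⟨rfl, h⟩
        refine ⟨⟨by omega, ?_⟩, by omega⟩
        rw [hj]
        push_cast
        ring
      · rintro ⟨⟨h, -⟩, rfl⟩
        omega
    · rw [if_neg hj, map_zero, if_neg]
      rintro ⟨⟨h1, h3⟩, rfl⟩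
      refine hj (add_right_cancel (h3.trans ?_))
      rw [add_assoc, ← Nat.cast_add, Nat.sub_add_cancel h1]
  rw [← LinearMap.comp_apply, this]
  split_ifs <;> rfl

theorem coef_V_eq_zero (i j : ZMod n) {l t : ℕ} (h : l < t) : coef (V hq i l) j t = 0 :=
  LinearMap.ext fun x => vCoord_ext fun a ha => by
    rw [vCoord_coef _ _ _ _ ha, if_neg (by omega), LinearMap.zero_apply, map_zero]

variable {W U : FDComodule k (CyclicHopf n q hq)}

theorem coef_of_coef_zero {i : ZMod n} {l : ℕ} {w : W.carrier} (h : coef W i l w = 0) {m : ℕ}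
    (hm : l ≤ m) : coef W i m w = 0 := by
  obtain ⟨t, rfl⟩ := Nat.exists_eq_add_of_le hm
  rw [← coef_coef_self, h, map_zero]

variable (W) in
/-- The linear map `V(i, l) → W`, `v_m ↦ E^m w`. -/
noncomputable def chain (i : ZMod n) (l : ℕ) (w : W.carrier) : (V hq i l).carrier →ₗ[k] W.carrier :=
  ∑ m ∈ Finset.range (l + 1), (vCoord hq i l m).smulRight (coef W i m w)

theorem chain_vec {i : ZMod n} {l : ℕ} {w : W.carrier} (h : coef W i (l + 1) w = 0) (m : ℕ) :
    chain W i l w (vec hq i l m) = coef W i m w := by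
  simp only [chain, LinearMap.sum_apply, LinearMap.smulRight_apply, vCoord_vec]
  by_cases hm : m ≤ l
  · rw [Finset.sum_eq_single m]
    · simp [hm]
    · intro b _ hb
      simp [hb]
    · intro h
      exact absurd (Finset.mem_range.2 (by omega)) h
  · rw [coef_of_coef_zero h (by omega)]
    simp [hm]

/-- The vector $w$ need not lie at the vertex $i$: $v_0$ goes to its component `coef W i 0 w`. The
hypothesis makes the image of the chain stop where $V(i,l)$ does. -/
theorem chain_isColinear {i : ZMod n} {l : ℕ} {w : W.carrier} (h : coef W i (l + 1) w = 0) :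
    IsColinear (V hq i l) W (chain W i l w) := by
  refine isColinear_iff.2 fun j t => LinearMap.congr_fun (f := coef W j t ∘ₗ chain W i l w)
    (g := chain W i l w ∘ₗ coef (V hq i l) j t) (vHom_ext fun m _ => ?_)
  rw [LinearMap.comp_apply, LinearMap.comp_apply, chain_vec h, coef_coef, coef_vec]
  split_ifs
  · rw [chain_vec h]
  · rw [map_zero]

variable (W) in
/-- The operator of degree one given by the action of the arrows. -/
noncomputable def shift : Module.End k W.carrier := ∑ i : ZMod n, coef W i 1

theorem shift_pow_apply (t : ℕ) (w : W.carrier) :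
    (shift W ^ t) w = ∑ i : ZMod n, coef W i t w := by
  induction t with
  | zero => rw [sum_coef_zero, pow_zero, Module.End.one_apply]
  | succ t ih =>
    rw [pow_succ', Module.End.mul_apply, ih, shift, LinearMap.sum_apply]
    simp only [map_sum, coef_coef]
    rw [Finset.sum_comm]
    refine Finset.sum_congr rfl fun i _ => ?_
    simp

variable (W) in
theorem shift_isNilpotent : ∃ N, shift W ^ N = 0 := by
  obtain ⟨N, hN⟩ := exists_coef_eq_zero W
  refine ⟨N, LinearMap.ext fun w => ?_⟩
  rw [shift_pow_apply]
  simp [hN]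

theorem IsColinear.shift {f : W.carrier →ₗ[k] U.carrier} (hf : IsColinear W U f) (w : W.carrier) :
    shift U (f w) = f (shift W w) := by
  rw [isColinear_iff] at hf
  simp [CyclicHopf.shift, hf]

/-- The kernel of the arrows on `V(i, l)` is spanned by the last basis vector. -/
theorem eq_smul_vec_of_shift_eq_zero {i : ZMod n} {l : ℕ} {x : (V hq i l).carrier}
    (h : shift (V hq i l) x = 0) : x = vCoord hq i l l x • vec hq i l l := by
  refine vCoord_ext fun a ha => ?_
  rw [map_smul, vCoord_vec, smul_eq_mul]
  by_cases hal : a = l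
  · simp [hal]
  -- For $a<l$ the coordinate $a$ of $x$ reappears as the coordinate $a+1$ of `shift x`, which is
  -- zero.
  · have h1 := congrArg (vCoord hq i l (a + 1)) h
    rw [shift, LinearMap.sum_apply, map_sum, map_zero] at h1
    simp only [vCoord_coef _ _ _ _ (show a + 1 ≤ l by omega)] at h1
    rw [Finset.sum_eq_single (i + a)] at h1
    · simpa [hal, add_assoc] using h1
    · intro j _ hj
      rw [if_neg]
      rintro ⟨-, h2⟩
      push_cast at h2
      exact hj (add_right_cancel (h2.trans (add_assoc _ _ _).symm))
    · simp

/-- A linear map which is injective on the kernel of a nilpotent operator, and whose kernel is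
stable, is injective. -/
theorem injective_of_nilpotent {M M' : Type*} [AddCommGroup M] [Module k M] [AddCommGroup M']
    [Module k M'] {f : M →ₗ[k] M'} {T : Module.End k M} {T' : Module.End k M'} {N : ℕ}
    (hT : T ^ N = 0) (hf : ∀ x, T' (f x) = f (T x)) (h : ∀ x, T x = 0 → f x = 0 → x = 0) :
    Function.Injective f := by
  have h' : ∀ t x, (T ^ t) x = 0 → f x = 0 → x = 0 := by
    intro t
    induction t with
    | zero => intro x hx _; simpa using hx
    | succ t ih =>
      intro x hx hfx
      refine h x (ih (T x) ?_ ?_) hfx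
      · rwa [pow_succ, Module.End.mul_apply] at hx
      · rw [← hf, hfx, map_zero]
  refine (injective_iff_map_eq_zero f).2 fun x hx => h' N x ?_ hx
  rw [hT]
  rfl

/-- The socle of $V(i,l)$ is the line of $v_l$, and $v_l$ goes to `coef W i l w`; a map that is
injective on the socle is injective. -/
theorem chain_injective {i : ZMod n} {l : ℕ} {w : W.carrier} (h : coef W i (l + 1) w = 0)
    (h0 : coef W i l w ≠ 0) : Function.Injective (chain W i l w) := by
  obtain ⟨N, hN⟩ := shift_isNilpotent (V hq i l)
  refine injective_of_nilpotent hN (IsColinear.shift (chain_isColinear h)) fun x hx hfx => ?_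
  rw [eq_smul_vec_of_shift_eq_zero hx, map_smul, chain_vec h, smul_eq_zero] at hfx
  rw [eq_smul_vec_of_shift_eq_zero hx, hfx.resolve_right h0, zero_smul]

theorem iso_of_chain {i : ZMod n} {l : ℕ} {w : W.carrier} (h : coef W i (l + 1) w = 0)
    (h0 : coef W i l w ≠ 0) (hdim : Module.finrank k W.carrier = l + 1) :
    Iso (V hq i l) W :=
  ⟨LinearEquiv.ofInjectiveOfFinrankEq (chain W i l w) (chain_injective h h0)
    ((finrank_V i l).trans hdim.symm), chain_isColinear h⟩

/-- A comodule spanned by two chains whose last vectors are linearly independent. -/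
theorem splitExact_of_chains {i j : ZMod n} {a b : ℕ} {w₁ w₂ : W.carrier}
    (h₁ : coef W i (a + 1) w₁ = 0) (h₂ : coef W j (b + 1) w₂ = 0)
    (hli : ∀ r s : k, r • coef W i a w₁ + s • coef W j b w₂ = 0 → r = 0 ∧ s = 0)
    (hdim : Module.finrank k W.carrier = a + 1 + (b + 1)) :
    SplitExact (V hq i a) W (V hq j b) := by
  have c₁ := chain_isColinear h₁
  have c₂ := chain_isColinear h₂
  refine splitExact_of_bijective c₁ c₂ ?_
  have hinj : Function.Injective ((chain W i a w₁).coprod (chain W j b w₂)) := by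
    obtain ⟨N₁, hN₁⟩ := shift_isNilpotent (V hq i a)
    obtain ⟨N₂, hN₂⟩ := shift_isNilpotent (V hq j b)
    -- On $V(i,a)\oplus V(j,b)$ the kernel of the shift is spanned by the two last basis vectors, so
    -- the independence of their images is all that injectivity requires. Surjectivity then follows
    -- from the dimensions.
    refine injective_of_nilpotent (T' := shift W) (N := N₁ + N₂)
      (T := (shift (V hq i a)).prodMap (shift (V hq j b))) ?_ ?_ ?_
    · have (t : ℕ) : (shift (V hq i a)).prodMap (shift (V hq j b)) ^ t
          = (shift (V hq i a) ^ t).prodMap (shift (V hq j b) ^ t) := by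
        induction t with
        | zero => rfl
        | succ t ih => rw [pow_succ, ih, pow_succ, pow_succ]; rfl
      rw [this, pow_add, pow_add, hN₁, hN₂, zero_mul, mul_zero, LinearMap.prodMap_zero]
    · rintro ⟨x, y⟩
      simp [IsColinear.shift c₁, IsColinear.shift c₂]
    · rintro ⟨x, y⟩ hxy hf
      rw [LinearMap.prodMap_apply, Prod.mk_eq_zero] at hxy
      rw [LinearMap.coprod_apply] at hf
      have hx := eq_smul_vec_of_shift_eq_zero hxy.1
      have hy := eq_smul_vec_of_shift_eq_zero hxy.2
      simp only at hf hx hy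
      rw [hx, hy, map_smul, map_smul, chain_vec h₁, chain_vec h₂] at hf
      obtain ⟨r0, s0⟩ := hli _ _ hf
      rw [hx, hy, r0, s0, zero_smul, zero_smul]
      rfl
  refine ⟨hinj, (LinearMap.injective_iff_surjective_of_finrank_eq_finrank ?_).1 hinj⟩
  rw [Module.finrank_prod, finrank_V, finrank_V, hdim]

end CyclicHopf

namespace CyclicHopf

open FDComodule Finset.HasAntidiagonal

variable {k : Type u} [Field k] {n : ℕ} [NeZero n] {q : k} {hq : q ^ n = 1}

variable {W U X Y Z : FDComodule k (CyclicHopf n q hq)}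

/-! ### Decomposition into the comodules `V(i, l)` -/

variable (W) in
/-- The linear map `W → V(i, l)` given by a functional on `W`. -/
noncomputable def cochain (i : ZMod n) (l : ℕ) (f : W.carrier →ₗ[k] k) :
    W.carrier →ₗ[k] (V hq i l).carrier :=
  ∑ m ∈ Finset.range (l + 1), (f ∘ₗ coef W (i + m) (l - m)).smulRight (vec hq i l m)

theorem vCoord_cochain (i : ZMod n) {l a : ℕ} (ha : a ≤ l) (f : W.carrier →ₗ[k] k) (w : W.carrier) :
    vCoord hq i l a (cochain W i l f w) = f (coef W (i + a) (l - a) w) := by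
  simp only [cochain, LinearMap.sum_apply, LinearMap.smulRight_apply, map_sum, map_smul, vCoord_vec,
    LinearMap.comp_apply, smul_eq_mul]
  rw [Finset.sum_eq_single a]
  · simp [ha]
  · intro b _ hb
    simp [hb.symm]
  · intro h
    exact absurd (Finset.mem_range.2 (by omega)) h

/-- Colinearity compares coordinate $a$ after a path of length $t$. If $t\le a$ both sides follow a
path of length $l-(a-t)$; if $t>a$ the composite path is longer than $l$ and must act by zero, which
is where the hypothesis enters. In effect $V(i,l)$ is injective among such comodules. -/
theorem cochain_isColinear (i : ZMod n) {l : ℕ} (f : W.carrier →ₗ[k] k)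
    (h : ∀ j t, l < t → coef W j t = 0) : IsColinear W (V hq i l) (cochain W i l f) := by
  refine isColinear_iff.2 fun j t w => vCoord_ext fun a ha => ?_
  rw [vCoord_coef _ _ _ _ ha, vCoord_cochain i ha, coef_coef]
  by_cases hta : t ≤ a
  · rw [vCoord_cochain i (by omega)]
    by_cases hj : j + t = i + a
    · have hj' : j = i + (a - t : ℕ) := by
        rw [Nat.cast_sub hta]
        linear_combination hj
      rw [if_pos ⟨hta, hj⟩, if_pos hj.symm, show l - (a - t) = t + (l - a) by omega, hj']
    · rw [if_neg fun h' => hj h'.2, if_neg fun h' => hj h'.symm, map_zero]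
  · rw [if_neg fun h' => hta h'.1, h j _ (by omega), LinearMap.zero_apply, ite_self, map_zero]

theorem SplitExact.exists_equiv (h : SplitExact X Y Z) :
    ∃ e : Y.carrier ≃ₗ[k] X.carrier × Z.carrier,
      ∀ i l y, e (coef Y i l y) = (coef X i l (e y).1, coef Z i l (e y).2) := by
  obtain ⟨i, p, r, s, hi, hp, hr, hs, h1, h2, h3, h4⟩ := h
  -- Sandwiching $ir+sp=1$ between $r$ and $s$ gives $rs+rs=rs$.
  have h5 : r ∘ₗ s = 0 := by
    have := congrArg (r ∘ₗ · ∘ₗ s) h4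
    simp only [LinearMap.add_comp, LinearMap.comp_add, LinearMap.comp_assoc, h3,
      LinearMap.id_comp, LinearMap.comp_id] at this
    rw [← LinearMap.comp_assoc _ i r, h2, LinearMap.id_comp] at this
    simpa using this
  rw [isColinear_iff] at hp hr
  have e1 := LinearMap.congr_fun h1
  have e2 := LinearMap.congr_fun h2
  have e3 := LinearMap.congr_fun h3
  have e5 := LinearMap.congr_fun h5
  simp only [LinearMap.comp_apply, LinearMap.zero_apply, LinearMap.id_apply] at e1 e2 e3 e5
  refine ⟨LinearEquiv.ofLinearMap (r.prod p) (i.coprod s) ?_ ?_, fun j l y => ?_⟩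
  · ext x <;> simp [e1, e2, e3, e5]
  · ext y
    exact LinearMap.congr_fun h4 y
  · simp [hp, hr]

theorem SplitExact.finrank_eq (h : SplitExact X Y Z) :
    Module.finrank k Y.carrier = Module.finrank k X.carrier + Module.finrank k Z.carrier := by
  obtain ⟨e, -⟩ := SplitExact.exists_equiv h
  rw [e.finrank_eq, Module.finrank_prod]

theorem SplitExact.coef_eq_zero (h : SplitExact X Y Z) {i : ZMod n} {l : ℕ} (hY : coef Y i l = 0) :
    coef Z i l = 0 := by
  obtain ⟨e, he⟩ := SplitExact.exists_equiv h
  refine LinearMap.ext fun z => ?_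
  have := he i l (e.symm (0, z))
  rw [hY] at this
  simpa using (congrArg Prod.snd this).symm

/-- A longest path acting nontrivially, say on $w$, generates a copy of $V(i,l)$. A functional with
value $1$ on the end of that chain and $0$ on its earlier vectors defines a colinear retraction onto
it. -/
theorem exists_splitExact_of_nontrivial [Nontrivial W.carrier] :
    ∃ (i : ZMod n) (l : ℕ) (Z : FDComodule k (CyclicHopf n q hq)),
      coef W i l ≠ 0 ∧ SplitExact (V hq i l) W Z := by
  classical
  obtain ⟨N, hN⟩ := exists_coef_eq_zero W
  have h0 : ∃ i, coef W i 0 ≠ 0 := by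
    by_contra! h
    obtain ⟨w, hw⟩ := exists_ne (0 : W.carrier)
    refine hw ?_
    rw [← sum_coef_zero w]
    simp [h]
  let P : ℕ → Prop := fun l => ∃ i, coef W i l ≠ 0
  have hP : P (Nat.findGreatest P N) := Nat.findGreatest_spec (Nat.zero_le N) h0
  set l := Nat.findGreatest P N with hl
  have hmax : ∀ j t, l < t → coef W j t = 0 := by
    intro j t ht
    by_contra hne
    rcases Nat.lt_or_ge N t with htN | htN
    · exact hne (hN j t htN.le)
    · exact Nat.findGreatest_is_greatest ht htN ⟨j, hne⟩
  obtain ⟨i, hi⟩ := hP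
  obtain ⟨w, hw⟩ : ∃ w, coef W i l w ≠ 0 := by
    by_contra! h
    exact hi (LinearMap.ext h)
  have hw1 : coef W i (l + 1) w = 0 := by rw [hmax i _ (Nat.lt_succ_self l)]; rfl
  obtain ⟨g, hg⟩ := LinearMap.exists_leftInverse_of_injective (chain W i l w)
    (LinearMap.ker_eq_bot.2 (chain_injective hw1 hw))
  let f := vCoord hq i l l ∘ₗ g
  have hf (t : ℕ) (ht : t ≤ l) : f (coef W i t w) = if t = l then 1 else 0 := by
    have h1 := LinearMap.congr_fun hg (vec hq i l t)
    rw [LinearMap.comp_apply, chain_vec hw1, LinearMap.id_apply] at h1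
    rw [LinearMap.comp_apply, h1, vCoord_vec]
    simp [ht, eq_comm]
  have hret : cochain W i l f ∘ₗ chain W i l w = LinearMap.id := by
    refine vHom_ext fun s hs => vCoord_ext fun a ha => ?_
    rw [LinearMap.comp_apply, chain_vec hw1, vCoord_cochain i ha, coef_coef, LinearMap.id_apply,
      vCoord_vec]
    -- The path applied to $w$ has length $l+s-a$: too long to act if $a<s$, the full chain if
    -- $a=s$, and a vector on which $f$ vanishes if $a>s$. The last case is needed when $a\equiv s$
    -- modulo $n$ with $a\ne s$.
    rcases lt_trichotomy a s with has | rfl | has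
    · rw [hmax i (s + (l - a)) (by omega), LinearMap.zero_apply, ite_self, map_zero,
        if_neg (by omega)]
    · rw [if_pos rfl, hf _ (by omega), if_pos (by omega), if_pos ⟨rfl, hs⟩]
    · rw [if_neg (show ¬ (a = s ∧ s ≤ l) by omega)]
      split_ifs
      · rw [hf _ (by omega), if_neg (by omega)]
      · rw [map_zero]
  obtain ⟨Z, hZ⟩ := exists_splitExact (chain_isColinear hw1) (cochain_isColinear i f hmax) hret
  exact ⟨i, l, Z, hi, hZ⟩

variable (n q hq) in
/-- The subgroup of the Green ring generated by the `[V(i, m)]` with `m < L`. -/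
noncomputable def filt (L : ℕ) : AddSubgroup (GreenRing k (CyclicHopf n q hq)) :=
  AddSubgroup.closure {x | ∃ i m, m < L ∧ x = GreenRing.of (V hq i m)}

theorem of_V_mem_filt (i : ZMod n) {m L : ℕ} (h : m < L) :
    GreenRing.of (V hq i m) ∈ filt n q hq L :=
  AddSubgroup.subset_closure ⟨i, m, h, rfl⟩

theorem filt_mono {L M : ℕ} (h : L ≤ M) : filt n q hq L ≤ filt n q hq M :=
  AddSubgroup.closure_mono fun _ ⟨i, m, hm, e⟩ => ⟨i, m, hm.trans_le h, e⟩

/-- For the zero comodule the sequence $0\to W\to W\to W\to0$ is split, so $[W]=[W]+[W]$. -/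
theorem of_eq_zero_of_subsingleton [Subsingleton W.carrier] : GreenRing.of W = 0 := by
  have h0 : (LinearMap.id : W.carrier →ₗ[k] W.carrier) = 0 := LinearMap.ext fun w => Subsingleton.elim _ _
  have h : SplitExact W W W :=
    ⟨.id, .id, .id, .id, isColinear_id W, isColinear_id W, isColinear_id W, isColinear_id W,
      by rw [h0, LinearMap.comp_zero], by simp, by simp, LinearMap.ext fun w => Subsingleton.elim _ _⟩
  simpa using GreenRing.of_splitExact h

/-- Induction on the dimension: a summand $V(i,l)$ with $l<L$ splits off, and the complement is
killed by the same paths. -/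
theorem of_mem_filt {L : ℕ} (h : ∀ i l, L ≤ l → coef W i l = 0) :
    GreenRing.of W ∈ filt n q hq L := by
  induction hd : Module.finrank k W.carrier using Nat.strong_induction_on generalizing W with
  | _ r ih =>
    rcases subsingleton_or_nontrivial W.carrier with hW | hW
    · rw [of_eq_zero_of_subsingleton]
      exact zero_mem _
    · obtain ⟨i, l, Z, hil, hZ⟩ := exists_splitExact_of_nontrivial (W := W)
      have hl : l < L := by
        by_contra hl
        exact hil (h i l (by omega))
      have hdim := SplitExact.finrank_eq hZ
      rw [finrank_V] at hdim
      rw [GreenRing.of_splitExact hZ]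
      exact add_mem (of_V_mem_filt i hl) (ih _ (by omega)
        (fun j t ht => SplitExact.coef_eq_zero hZ (h j t ht)) rfl)

theorem exists_mem_filt (x : GreenRing k (CyclicHopf n q hq)) : ∃ L, x ∈ filt n q hq L := by
  induction x using GreenRing.induction_on with
  | of W =>
    obtain ⟨N, hN⟩ := exists_coef_eq_zero W
    exact ⟨N, of_mem_filt hN⟩
  | neg x hx =>
    obtain ⟨L, hL⟩ := hx
    exact ⟨L, neg_mem hL⟩
  | add x y hx hy =>
    obtain ⟨L, hL⟩ := hx
    obtain ⟨M, hM⟩ := hy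
    exact ⟨max L M, add_mem (filt_mono (le_max_left _ _) hL) (filt_mono (le_max_right _ _) hM)⟩

/-! ### Ranks -/

variable (n q hq) in
-- A splitting makes the operators block diagonal, so their ranks add. These invariants play the
-- part of the uniqueness in the Krull–Schmidt theorem.
theorem exists_rankHom (i : ZMod n) (l : ℕ) : ∃ F : GreenRing k (CyclicHopf n q hq) →+ ℤ,
    ∀ W, F (GreenRing.of W) = Module.finrank k (LinearMap.range (coef W i l)) := by
  refine GreenRing.exists_addMonoidHom
    (fun W => (Module.finrank k (LinearMap.range (coef W i l)) : ℤ)) ?_ ?_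
  · rintro U W ⟨e, he⟩
    rw [isColinear_iff] at he
    have : LinearMap.range (coef W i l) = (LinearMap.range (coef U i l)).map e.toLinearMap := by
      ext w
      simp only [LinearMap.mem_range, Submodule.mem_map]
      constructor
      · rintro ⟨x, rfl⟩
        obtain ⟨y, rfl⟩ := e.surjective x
        exact ⟨_, ⟨y, rfl⟩, (he i l y).symm⟩
      · rintro ⟨_, ⟨y, rfl⟩, rfl⟩
        exact ⟨_, he i l y⟩
    rw [this, LinearEquiv.finrank_map_eq]
  · intro X Y Z h
    obtain ⟨e, he⟩ := SplitExact.exists_equiv h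
    have : (LinearMap.range (coef Y i l)).map e.toLinearMap
        = (LinearMap.range (coef X i l)).prod (LinearMap.range (coef Z i l)) := by
      ext ⟨x, z⟩
      simp only [LinearMap.mem_range, Submodule.mem_map, Submodule.mem_prod]
      constructor
      · rintro ⟨_, ⟨y, rfl⟩, hy⟩
        have := (he i l y).symm.trans hy
        exact ⟨⟨_, congrArg Prod.fst this⟩, ⟨_, congrArg Prod.snd this⟩⟩
      · rintro ⟨⟨x, rfl⟩, ⟨z, rfl⟩⟩
        refine ⟨_, ⟨e.symm (x, z), rfl⟩, ?_⟩
        refine (he _ _ _).trans ?_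
        simp
    let E : (LinearMap.range (coef X i l)).prod (LinearMap.range (coef Z i l)) ≃ₗ[k]
        LinearMap.range (coef X i l) × LinearMap.range (coef Z i l) :=
      { toFun := fun z => (⟨z.1.1, z.2.1⟩, ⟨z.1.2, z.2.2⟩)
        map_add' := fun _ _ => rfl
        map_smul' := fun _ _ => rfl
        invFun := fun z => ⟨(z.1.1, z.2.1), ⟨z.1.2, z.2.2⟩⟩ }
    rw [← LinearEquiv.finrank_map_eq e (LinearMap.range (coef Y i l)), this,
      E.finrank_eq, Module.finrank_prod, Nat.cast_add]

variable (n q hq) in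
/-- The additive extension of the rank of `coef W i l` to the Green ring. -/
noncomputable def rankHom (i : ZMod n) (l : ℕ) : GreenRing k (CyclicHopf n q hq) →+ ℤ :=
  (exists_rankHom n q hq i l).choose

theorem rankHom_of (i : ZMod n) (l : ℕ) (W : FDComodule k (CyclicHopf n q hq)) :
    rankHom n q hq i l (GreenRing.of W) = Module.finrank k (LinearMap.range (coef W i l)) :=
  (exists_rankHom n q hq i l).choose_spec W

theorem rankHom_of_mem_filt {i : ZMod n} {l L : ℕ} (hL : L ≤ l)
    {x : GreenRing k (CyclicHopf n q hq)} (hx : x ∈ filt n q hq L) : rankHom n q hq i l x = 0 := by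
  have : filt n q hq L ≤ (rankHom n q hq i l).ker := by
    refine (AddSubgroup.closure_le _).2 ?_
    rintro _ ⟨j, m, hm, rfl⟩
    rw [SetLike.mem_coe, AddMonoidHom.mem_ker, rankHom_of, coef_V_eq_zero j i (by omega),
      LinearMap.range_zero, finrank_bot, Nat.cast_zero]
  exact this hx

theorem finrank_range_smulRight {M M' : Type*} [AddCommGroup M] [Module k M] [AddCommGroup M']
    [Module k M'] {f : M →ₗ[k] k} {v : M'} (hf : f ≠ 0) (hv : v ≠ 0) :
    Module.finrank k (LinearMap.range (f.smulRight v)) = 1 := by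
  have : LinearMap.range (f.smulRight v) = k ∙ v := by
    ext x
    rw [LinearMap.mem_range, Submodule.mem_span_singleton]
    constructor
    · rintro ⟨y, rfl⟩
      exact ⟨_, rfl⟩
    · rintro ⟨a, rfl⟩
      obtain ⟨y, rfl⟩ := LinearMap.surjective hf a
      exact ⟨y, rfl⟩
  rw [this, finrank_span_singleton hv]

theorem vec_ne_zero (i : ZMod n) {l m : ℕ} (h : m ≤ l) : vec hq i l m ≠ 0 := by
  intro h0
  have := vCoord_vec (hq := hq) i l m m
  rw [h0, map_zero] at this
  simp [h] at this

theorem vCoord_ne_zero (i : ZMod n) {l m : ℕ} (h : m ≤ l) : vCoord hq i l m ≠ 0 := by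
  intro h0
  have := vCoord_vec (hq := hq) i l m m
  rw [h0, LinearMap.zero_apply] at this
  simp [h] at this

/-- On $V(j,l)$ the only path of length $l$ with nonzero action is $p_j^l$, which takes $v_0$ to
$v_l$ and has rank one. -/
theorem rankHom_V (i j : ZMod n) (l : ℕ) :
    rankHom n q hq i l (GreenRing.of (V hq j l)) = if i = j then 1 else 0 := by
  have h : coef (V hq j l) i l = if i = j then (vCoord hq j l 0).smulRight (vec hq j l l) else 0 := by
    refine vHom_ext fun m hm => ?_
    rw [coef_vec]
    by_cases hm0 : m = 0
    · subst hm0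
      rw [Nat.cast_zero, add_zero, zero_add]
      split_ifs
      · simp [vCoord_vec]
      · rfl
    · rw [vec_eq_zero (by omega), ite_self]
      split_ifs
      · simp [vCoord_vec, Ne.symm hm0]
      · rfl
  rw [rankHom_of]
  by_cases hij : i = j
  · rw [if_pos hij] at h ⊢
    rw [h, finrank_range_smulRight (vCoord_ne_zero j (Nat.zero_le _)) (vec_ne_zero j le_rfl),
      Nat.cast_one]
  · rw [if_neg hij] at h ⊢
    rw [h, LinearMap.range_zero, finrank_bot, Nat.cast_zero]

/-- The rank functionals of length $L$ are the coordinates on `filt (L + 1)` modulo `filt L`. -/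
theorem sub_sum_rankHom_mem_filt {L : ℕ} {x : GreenRing k (CyclicHopf n q hq)}
    (hx : x ∈ filt n q hq (L + 1)) :
    x - ∑ i : ZMod n, rankHom n q hq i L x • GreenRing.of (V hq i L) ∈ filt n q hq L := by
  induction hx using AddSubgroup.closure_induction with
  | mem x h =>
    obtain ⟨j, m, hm, rfl⟩ := h
    rcases Nat.lt_succ_iff_lt_or_eq.1 hm with hm | rfl
    · rw [Finset.sum_eq_zero, sub_zero]
      · exact of_V_mem_filt j hm
      · intro i _
        rw [rankHom_of_mem_filt le_rfl (of_V_mem_filt j hm), zero_smul]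
    · simp only [rankHom_V, ite_smul, one_smul, zero_smul, Finset.sum_ite_eq', Finset.mem_univ,
        if_true, sub_self]
      exact zero_mem _
  | zero => simp
  | add x y _ _ hx hy =>
    simp only [map_add, add_smul, Finset.sum_add_distrib]
    rw [add_sub_add_comm]
    exact add_mem hx hy
  | neg x _ hx =>
    simp only [map_neg, neg_smul, Finset.sum_neg_distrib]
    rw [← neg_sub']
    exact neg_mem hx

end CyclicHopf

namespace CyclicHopf

open FDComodule Finset.HasAntidiagonal

variable {k : Type u} [Field k] {n : ℕ} [NeZero n] {q : k} {hq : q ^ n = 1}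

/-! ### Tensor products of the comodules `V(i, l)` -/

theorem qBinom_one_right (q : k) (t : ℕ) : qBinom q t 1 = qInt q t := by
  induction t with
  | zero => simp [qBinom, qInt]
  | succ t ih =>
    rw [qBinom_succ_succ, ih, add_comm t 1, qInt_add]
    simp [qInt]

theorem qBinom_succ_self (q : k) (t : ℕ) : qBinom q (t + 1) t = qInt q (t + 1) := by
  rw [qBinom_symm, add_comm 1 t, qBinom_one_right]

theorem qPow_one {n : ℕ} (hq : q ^ n = 1) : qPow q (1 : ZMod n) = q := by
  have := qPow_natCast hq 1
  rwa [Nat.cast_one, pow_one] at this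

variable (hq) in
/-- The basis vector `v_r ⊗ v_s` of `V(i, a) ⊗ V(j, b)`. -/
noncomputable def vec₂ (i j : ZMod n) (a b r s : ℕ) : (tensor (V hq i a) (V hq j b)).carrier :=
  tmul (vec hq i a r) (vec hq j b s)

variable (hq) in
/-- The coordinate functionals on `V(i, a) ⊗ V(j, b)`. -/
noncomputable def vCoord₂ (i j : ZMod n) (a b r s : ℕ) :
    (tensor (V hq i a) (V hq j b)).carrier →ₗ[k] k :=
  LinearMap.mul' k k ∘ₗ TensorProduct.map (vCoord hq i a r) (vCoord hq j b s)

section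

variable {i j : ZMod n} {a b : ℕ}

theorem vec₂_eq_zero_left {r s : ℕ} (h : a < r) : vec₂ hq i j a b r s = 0 := by
  rw [vec₂, vec_eq_zero h]
  exact TensorProduct.zero_tmul _ _

theorem vec₂_eq_zero_right {r s : ℕ} (h : b < s) : vec₂ hq i j a b r s = 0 := by
  rw [vec₂, vec_eq_zero h]
  exact TensorProduct.tmul_zero _ _

theorem vCoord₂_vec₂ (r s r' s' : ℕ) : vCoord₂ hq i j a b r s (vec₂ hq i j a b r' s')
    = if (r = r' ∧ r' ≤ a) ∧ (s = s' ∧ s' ≤ b) then 1 else 0 := by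
  change LinearMap.mul' k k (TensorProduct.map _ _ (vec hq i a r' ⊗ₜ[k] vec hq j b s')) = _
  rw [TensorProduct.map_tmul, LinearMap.mul'_apply, vCoord_vec, vCoord_vec, ite_zero_mul_ite_zero,
    mul_one]

theorem vHom₂_ext {M : Type*} [AddCommGroup M] [Module k M]
    {f g : (tensor (V hq i a) (V hq j b)).carrier →ₗ[k] M}
    (h : ∀ r ≤ a, ∀ s ≤ b, f (vec₂ hq i j a b r s) = g (vec₂ hq i j a b r s)) : f = g :=
  TensorProduct.ext (vHom_ext fun r hr => vHom_ext fun s hs => h r hr s hs)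

theorem finrank_tensor_V :
    Module.finrank k (tensor (V hq i a) (V hq j b)).carrier = (a + 1) * (b + 1) := by
  change Module.finrank k ((V hq i a).carrier ⊗[k] (V hq j b).carrier) = _
  rw [Module.finrank_tensorProduct, finrank_V, finrank_V]

theorem coef_vec₂ (p : ZMod n) (l r s : ℕ) :
    coef (tensor (V hq i a) (V hq j b)) p l (vec₂ hq i j a b r s)
      = if p = (i + r) + (j + s) then ∑ y ∈ antidiagonal l,
        (qPow q (i + (r : ZMod n)) ^ y.2 * qBinom q l y.1) • vec₂ hq i j a b (r + y.1) (s + y.2) else 0 := by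
  have h1 : coef (V hq i a) (i + r) 0 (vec hq i a r) = vec hq i a r := by
    rw [coef_vec, if_pos rfl, add_zero]
  have h2 : coef (V hq j b) (j + s) 0 (vec hq j b s) = vec hq j b s := by
    rw [coef_vec, if_pos rfl, add_zero]
  simp only [vec₂, coef_tensor h1 h2, coef_vec, if_true]

/-- However a path longer than $a+b$ is divided between the factors, it runs off the end of one of
them. -/
theorem coef_tensor_V_eq_zero (p : ZMod n) {l : ℕ} (hl : a + b < l) :
    coef (tensor (V hq i a) (V hq j b)) p l = 0 := by
  refine vHom₂_ext fun r _ s _ => ?_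
  rw [coef_vec₂, LinearMap.zero_apply, Finset.sum_eq_zero, ite_self]
  rintro ⟨y, z⟩ hy
  rw [mem_antidiagonal] at hy
  simp only at hy ⊢
  rcases Nat.lt_or_ge a (r + y) with h | h
  · rw [vec₂_eq_zero_left h, smul_zero]
  · rw [vec₂_eq_zero_right (by omega), smul_zero]

/-- A path of length $a+b$ must take $a$ steps in the first factor and $b$ in the second, starting
from $v_0\otimes v_0$. -/
theorem coef_top_vec₂ (p : ZMod n) (r s : ℕ) :
    coef (tensor (V hq i a) (V hq j b)) p (a + b) (vec₂ hq i j a b r s)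
      = if (r = 0 ∧ s = 0) ∧ p = i + j then
        (qPow q i ^ b * qBinom q (a + b) a) • vec₂ hq i j a b a b else 0 := by
  have hne (y : ℕ × ℕ) (hy : y ∈ antidiagonal (a + b)) (h : a < r + y.1 ∨ b < s + y.2) :
      (qPow q (i + (r : ZMod n)) ^ y.2 * qBinom q (a + b) y.1) • vec₂ hq i j a b (r + y.1) (s + y.2) = 0 := by
    rcases h with h | h
    · rw [vec₂_eq_zero_left h, smul_zero]
    · rw [vec₂_eq_zero_right h, smul_zero]
  rw [coef_vec₂]
  by_cases hrs : r = 0 ∧ s = 0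
  · obtain ⟨rfl, rfl⟩ := hrs
    rw [Finset.sum_eq_single (a, b)]
    · simp
    · rintro ⟨y, z⟩ hy hne'
      refine hne _ hy ?_
      rw [mem_antidiagonal] at hy
      simp only [ne_eq, Prod.mk.injEq] at hy hne' ⊢
      omega
    · simp
  · rw [if_neg (fun h : (r = 0 ∧ s = 0) ∧ p = i + j => hrs h.1), Finset.sum_eq_zero, ite_self]
    rintro ⟨y, z⟩ hy
    refine hne _ hy ?_
    rw [mem_antidiagonal] at hy
    simp only at hy ⊢
    omega

theorem of_mul_of_mem_filt :
    GreenRing.of (V hq i a) * GreenRing.of (V hq j b) ∈ filt n q hq (a + b + 1) := by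
  rw [GreenRing.of_mul]
  exact of_mem_filt fun p l hl => coef_tensor_V_eq_zero p hl

theorem of_mul_mem_filt {L : ℕ} {x : GreenRing k (CyclicHopf n q hq)} (hx : x ∈ filt n q hq L) :
    GreenRing.of (V hq i a) * x ∈ filt n q hq (L + a) := by
  induction hx using AddSubgroup.closure_induction with
  | mem x h =>
    obtain ⟨j, m, hm, rfl⟩ := h
    exact filt_mono (by omega) of_mul_of_mem_filt
  | zero => rw [mul_zero]; exact zero_mem _
  | add x y _ _ hx hy => rw [mul_add]; exact add_mem hx hy
  | neg x _ hx => rw [mul_neg]; exact neg_mem hx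

/-- The leading term of a product. -/
theorem of_mul_of_sub_mem_filt (h : qBinom q (a + b) a ≠ 0) :
    GreenRing.of (V hq i a) * GreenRing.of (V hq j b) - GreenRing.of (V hq (i + j) (a + b))
      ∈ filt n q hq (a + b) := by
  have h1 := sub_sum_rankHom_mem_filt (of_mul_of_mem_filt (hq := hq) (i := i) (j := j) (a := a) (b := b))
  have hc : qPow q i ^ b * qBinom q (a + b) a ≠ 0 := mul_ne_zero (pow_ne_zero _ (qPow_ne_zero hq i)) h
  -- By `coef_top_vec₂` the operators of length $a+b$ have rank one for $p=i+j$, thanks to the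
  -- nonzero binomial, and vanish otherwise.
  have h2 (p : ZMod n) : rankHom n q hq p (a + b) (GreenRing.of (V hq i a) * GreenRing.of (V hq j b))
      = if p = i + j then 1 else 0 := by
    have e : coef (tensor (V hq i a) (V hq j b)) p (a + b) = if p = i + j then
        (vCoord₂ hq i j a b 0 0).smulRight ((qPow q i ^ b * qBinom q (a + b) a) • vec₂ hq i j a b a b)
        else 0 := by
      refine vHom₂_ext fun r _ s _ => ?_
      rw [coef_top_vec₂]
      by_cases hp : p = i + j
      · rw [if_pos hp, LinearMap.smulRight_apply, vCoord₂_vec₂]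
        by_cases hrs : r = 0 ∧ s = 0
        · simp [hrs, hp]
        · rw [if_neg fun h => hrs h.1, if_neg, zero_smul]
          omega
      · rw [if_neg hp, if_neg fun h => hp h.2]
        rfl
    rw [GreenRing.of_mul, rankHom_of]
    by_cases hp : p = i + j
    · rw [if_pos hp] at e ⊢
      rw [e, finrank_range_smulRight, Nat.cast_one]
      · intro h0
        have := vCoord₂_vec₂ (hq := hq) (i := i) (j := j) (a := a) (b := b) 0 0 0 0
        rw [h0] at this
        simp at this
      · refine smul_ne_zero hc fun h0 => ?_
        have := vCoord₂_vec₂ (hq := hq) (i := i) (j := j) (a := a) (b := b) a b a b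
        rw [h0] at this
        simp at this
    · rw [if_neg hp] at e ⊢
      rw [e, LinearMap.range_zero, finrank_bot, Nat.cast_zero]
  simpa only [h2, ite_smul, one_smul, zero_smul, Finset.sum_ite_eq', Finset.mem_univ, if_true]
    using h1

/-- The condition `hab` says $ab=0$. One chain then fills the whole tensor product, and there are no
lower terms. -/
theorem iso_tensor_of_finrank_eq (h : qBinom q (a + b) a ≠ 0) (hab : (a + 1) * (b + 1) = a + b + 1) :
    GreenRing.of (V hq i a) * GreenRing.of (V hq j b) = GreenRing.of (V hq (i + j) (a + b)) := by
  rw [GreenRing.of_mul]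
  refine (GreenRing.of_congr (iso_of_chain (w := vec₂ hq i j a b 0 0) ?_ ?_ ?_)).symm
  · rw [coef_tensor_V_eq_zero _ (Nat.lt_succ_self _)]
    rfl
  · rw [coef_top_vec₂, if_pos ⟨⟨rfl, rfl⟩, rfl⟩]
    refine smul_ne_zero (mul_ne_zero (pow_ne_zero _ (qPow_ne_zero hq i)) h) fun h0 => ?_
    have := vCoord₂_vec₂ (hq := hq) (i := i) (j := j) (a := a) (b := b) a b a b
    rw [h0] at this
    simp at this
  · rw [finrank_tensor_V, hab]

theorem of_V_zero_mul (i j : ZMod n) (l : ℕ) :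
    GreenRing.of (V hq i 0) * GreenRing.of (V hq j l) = GreenRing.of (V hq (i + j) l) := by
  have := iso_tensor_of_finrank_eq (hq := hq) (i := i) (j := j) (a := 0) (b := l) (by simp) (by omega)
  rwa [zero_add] at this

theorem of_mul_V_zero (i j : ZMod n) (l : ℕ) :
    GreenRing.of (V hq i l) * GreenRing.of (V hq j 0) = GreenRing.of (V hq (i + j) l) :=
  iso_tensor_of_finrank_eq (hq := hq) (i := i) (j := j) (a := l) (b := 0) (by simp) (by omega)

end

/-! ### Products with $V(0,1)$ -/

section

variable {l : ℕ}

/-- When the left factor is two-dimensional, at most one step of a path can be taken in it. -/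
theorem sum_antidiagonal_left {M : Type*} [AddCommMonoid M] (f : ℕ → ℕ → M)
    (h : ∀ r s, 2 ≤ r → f r s = 0) (t : ℕ) :
    ∑ y ∈ antidiagonal t, f y.1 y.2 = f 0 t + if t = 0 then 0 else f 1 (t - 1) := by
  rcases t with - | - | t
  · simp
  · simp [Finset.Nat.sum_antidiagonal_succ]
  · rw [Finset.Nat.sum_antidiagonal_succ, Finset.Nat.sum_antidiagonal_succ, Finset.sum_eq_zero]
    · simp
    · intro y _
      exact h _ _ (by omega)

theorem sum_antidiagonal_right {M : Type*} [AddCommMonoid M] (f : ℕ → ℕ → M)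
    (h : ∀ r s, 2 ≤ s → f r s = 0) (t : ℕ) :
    ∑ y ∈ antidiagonal t, f y.1 y.2 = f t 0 + if t = 0 then 0 else f (t - 1) 1 := by
  rw [← sum_antidiagonal_left (fun r s => f s r) (fun r s hr => h s r hr), ← Finset.Nat.sum_antidiagonal_swap]
  rfl

/-- At $t=0$ the truncated index $s+t-1$ is harmless, since its coefficient $0_q$ vanishes. -/
theorem coef_vec₂_zero_left (s t : ℕ) (p : ZMod n) (hp : p = s) :
    coef (tensor (V hq 0 1) (V hq 0 l)) p t (vec₂ hq 0 0 1 l 0 s)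
      = vec₂ hq 0 0 1 l 0 (s + t) + qInt q t • vec₂ hq 0 0 1 l 1 (s + t - 1) := by
  rw [coef_vec₂, if_pos (by simp [hp]),
    sum_antidiagonal_left (fun y z => (qPow q (0 + ((0 : ℕ) : ZMod n)) ^ z * qBinom q t y) •
      vec₂ hq 0 0 1 l (0 + y) (s + z))]
  · rcases t with - | t
    · simp [qPow_zero, qInt]
    · simp [qPow_zero, qBinom_one_right, ← add_assoc]
  · intro r _ hr
    rw [vec₂_eq_zero_left (by omega), smul_zero]

theorem coef_vec₂_one_left (s t : ℕ) (p : ZMod n) (hp : p = 1 + s) :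
    coef (tensor (V hq 0 1) (V hq 0 l)) p t (vec₂ hq 0 0 1 l 1 s)
      = q ^ t • vec₂ hq 0 0 1 l 1 (s + t) := by
  rw [coef_vec₂, if_pos (by simp [hp]),
    sum_antidiagonal_left (fun y z => (qPow q (0 + ((1 : ℕ) : ZMod n)) ^ z * qBinom q t y) •
      vec₂ hq 0 0 1 l (1 + y) (s + z))]
  · rw [vec₂_eq_zero_left (r := 1 + 1) (by omega), smul_zero, ite_self, Nat.cast_one, zero_add,
      qPow_one hq]
    simp
  · intro r _ hr
    rw [vec₂_eq_zero_left (by omega), smul_zero]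

theorem coef_vec₂_zero_right (s t : ℕ) (p : ZMod n) (hp : p = s) :
    coef (tensor (V hq 0 l) (V hq 0 1)) p t (vec₂ hq 0 0 l 1 s 0)
      = vec₂ hq 0 0 l 1 (s + t) 0 + (q ^ s * qInt q t) • vec₂ hq 0 0 l 1 (s + t - 1) 1 := by
  rw [coef_vec₂, if_pos (by simp [hp]),
    sum_antidiagonal_right (fun y z => (qPow q (0 + (s : ZMod n)) ^ z * qBinom q t y) •
      vec₂ hq 0 0 l 1 (s + y) (0 + z))]
  · rcases t with - | t
    · simp [qInt]
    · simp [qPow_natCast hq, qBinom_succ_self, ← add_assoc]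
  · intro _ r hr
    rw [vec₂_eq_zero_right (by omega), smul_zero]

theorem coef_vec₂_one_right (s t : ℕ) (p : ZMod n) (hp : p = 1 + s) :
    coef (tensor (V hq 0 l) (V hq 0 1)) p t (vec₂ hq 0 0 l 1 s 1)
      = vec₂ hq 0 0 l 1 (s + t) 1 := by
  rw [coef_vec₂, if_pos (by simp [hp, add_comm]),
    sum_antidiagonal_right (fun y z => (qPow q (0 + (s : ZMod n)) ^ z * qBinom q t y) •
      vec₂ hq 0 0 l 1 (s + y) (1 + z))]
  · rw [vec₂_eq_zero_right (s := 1 + 1) (by omega), smul_zero, ite_self]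
    simp
  · intro _ r hr
    rw [vec₂_eq_zero_right (by omega), smul_zero]

/-- The chain from $v_0\otimes v_0$ ends in $(l+2)_q\,v_1\otimes v_{l+1}\ne0$ after $l+2$ steps. The
second chain starts at the vertex $1$, from a combination of $v_0\otimes v_1$ and $v_1\otimes v_0$.
Paths of length $l+1$ take these to $(l+1)_q\,v_1\otimes v_{l+1}$ and $q^{l+1}v_1\otimes v_{l+1}$,
which fixes the coefficient that makes the chain stop. -/
theorem V_one_mul_V (h : qInt q (l + 2) ≠ 0) :
    GreenRing.of (V hq 0 1) * GreenRing.of (V hq 0 (l + 1))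
      = GreenRing.of (V hq 0 (l + 2)) + GreenRing.of (V hq 1 l) := by
  have hq0 : q ≠ 0 := qPow_one hq ▸ qPow_ne_zero hq 1
  rw [GreenRing.of_mul]
  refine GreenRing.of_splitExact (splitExact_of_chains (w₁ := vec₂ hq 0 0 1 (l + 1) 0 0)
    (w₂ := vec₂ hq 0 0 1 (l + 1) 0 1 - (qInt q (l + 1) / q ^ (l + 1)) • vec₂ hq 0 0 1 (l + 1) 1 0)
    ?_ ?_ ?_ ?_)
  · rw [coef_vec₂_zero_left _ _ _ (by simp), vec₂_eq_zero_right (by omega),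
      vec₂_eq_zero_right (by omega), smul_zero, add_zero]
  · rw [map_sub, map_smul, coef_vec₂_zero_left _ _ _ (by simp), coef_vec₂_one_left _ _ _ (by simp),
      vec₂_eq_zero_right (by omega), smul_smul, div_mul_cancel₀ _ (pow_ne_zero _ hq0), zero_add,
      show 1 + (l + 1) - 1 = 0 + (l + 1) by omega, sub_self]
  · intro r s hrs
    rw [map_sub, map_smul, coef_vec₂_zero_left _ _ _ (by simp), coef_vec₂_zero_left _ _ _ (by simp),
      coef_vec₂_one_left _ _ _ (by simp), vec₂_eq_zero_right (s := 0 + (l + 2)) (by omega)] at hrs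
    have h1 := congrArg (vCoord₂ hq 0 0 1 (l + 1) 0 (l + 1)) hrs
    have h2 := congrArg (vCoord₂ hq 0 0 1 (l + 1) 1 (l + 1)) hrs
    simp [vCoord₂_vec₂, h, add_comm] at h1 h2
    exact ⟨h2, h1⟩
  · rw [finrank_tensor_V]
    ring

/-- The mirror image of `V_one_mul_V`, needed for commutativity. Here $l+1$ steps take $v_1\otimes
v_0$ to $q\,(l+1)_q\,v_{l+1}\otimes v_1$ and $v_0\otimes v_1$ to $v_{l+1}\otimes v_1$, whence the
coefficient. -/
theorem V_mul_V_one (h : qInt q (l + 2) ≠ 0) :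
    GreenRing.of (V hq 0 (l + 1)) * GreenRing.of (V hq 0 1)
      = GreenRing.of (V hq 0 (l + 2)) + GreenRing.of (V hq 1 l) := by
  rw [GreenRing.of_mul]
  refine GreenRing.of_splitExact (splitExact_of_chains (w₁ := vec₂ hq 0 0 (l + 1) 1 0 0)
    (w₂ := vec₂ hq 0 0 (l + 1) 1 1 0 - (q * qInt q (l + 1)) • vec₂ hq 0 0 (l + 1) 1 0 1)
    ?_ ?_ ?_ ?_)
  · rw [coef_vec₂_zero_right _ _ _ (by simp), vec₂_eq_zero_left (by omega),
      vec₂_eq_zero_left (by omega), smul_zero, add_zero]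
  · rw [map_sub, map_smul, coef_vec₂_zero_right _ _ _ (by simp), coef_vec₂_one_right _ _ _ (by simp),
      vec₂_eq_zero_left (by omega), zero_add, pow_one,
      show 1 + (l + 1) - 1 = 0 + (l + 1) by omega, sub_self]
  · intro r s hrs
    rw [map_sub, map_smul, coef_vec₂_zero_right _ _ _ (by simp),
      coef_vec₂_zero_right _ _ _ (by simp),
      coef_vec₂_one_right _ _ _ (by simp), vec₂_eq_zero_left (r := 0 + (l + 2)) (by omega)] at hrs
    have h1 := congrArg (vCoord₂ hq 0 0 (l + 1) 1 (l + 1) 0) hrs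
    have h2 := congrArg (vCoord₂ hq 0 0 (l + 1) 1 (l + 1) 1) hrs
    simp [vCoord₂_vec₂, h, add_comm] at h1 h2
    exact ⟨h2, h1⟩
  · rw [finrank_tensor_V]
    ring

/-- Since $(l+1)_q=0$, the chain from $v_0\otimes v_0$ already stops after $l$ steps; the chain from
$v_1\otimes v_0$ has the same length and supplies the rest. -/
theorem V_one_mul_V_of_qInt_eq_zero (h : qInt q (l + 1) = 0) :
    GreenRing.of (V hq 0 1) * GreenRing.of (V hq 0 l)
      = GreenRing.of (V hq 0 l) + GreenRing.of (V hq 1 l) := by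
  have hq0 : q ≠ 0 := qPow_one hq ▸ qPow_ne_zero hq 1
  rw [GreenRing.of_mul]
  refine GreenRing.of_splitExact (splitExact_of_chains (w₁ := vec₂ hq 0 0 1 l 0 0)
    (w₂ := vec₂ hq 0 0 1 l 1 0) ?_ ?_ ?_ ?_)
  · rw [coef_vec₂_zero_left _ _ _ (by simp), vec₂_eq_zero_right (by omega), h, zero_smul, add_zero]
  · rw [coef_vec₂_one_left _ _ _ (by simp), vec₂_eq_zero_right (by omega), smul_zero]
  · intro r s hrs
    rw [coef_vec₂_zero_left _ _ _ (by simp), coef_vec₂_one_left _ _ _ (by simp)] at hrs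
    have h1 := congrArg (vCoord₂ hq 0 0 1 l 0 l) hrs
    simp [vCoord₂_vec₂] at h1
    have h2 := congrArg (vCoord₂ hq 0 0 1 l 1 l) hrs
    simp [vCoord₂_vec₂, h1, hq0] at h2
    exact ⟨h1, h2⟩
  · rw [finrank_tensor_V]
    ring

end

end CyclicHopf

/-! ### The polynomials `fibPoly` -/

section FibPoly

/-- The added binomials have $l-i<i$ and vanish; the longer range spares the recurrence a case
distinction on parity. -/
theorem fibPoly_succ (l : ℕ) : fibPoly (l + 1) = ∑ i ∈ Finset.range (l + 1),
    (-1) ^ i * ((l - i).choose i : MvPolynomial (Fin 3) ℤ) *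
      MvPolynomial.X 0 ^ i * MvPolynomial.X 1 ^ (l - 2 * i) := by
  rw [fibPoly, Nat.add_sub_cancel]
  refine Finset.sum_subset (Finset.range_subset_range.2 (by omega)) fun i hi hi' => ?_
  rw [Finset.mem_range] at hi hi'
  rw [Nat.choose_eq_zero_of_lt (by omega)]
  simp

theorem fibPoly_one : fibPoly 1 = 1 := by simp [fibPoly]

theorem fibPoly_two : fibPoly 2 = MvPolynomial.X 1 := by simp [fibPoly]

/-- Pascal's rule. It is the same recurrence as `V_one_mul_V`, which is why these polynomials occur.
-/
theorem fibPoly_add_three (l : ℕ) : fibPoly (l + 3)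
    = MvPolynomial.X 1 * fibPoly (l + 2) - MvPolynomial.X 0 * fibPoly (l + 1) := by
  rw [fibPoly_succ (l + 2), fibPoly_succ (l + 1), fibPoly_succ l, Finset.sum_range_succ' _ (l + 2),
    Finset.sum_range_succ _ (l + 1), Finset.sum_range_succ' _ (l + 1),
    mul_add (MvPolynomial.X 1 : MvPolynomial (Fin 3) ℤ), Finset.mul_sum,
    Finset.mul_sum]
  have h : ∀ j ∈ Finset.range (l + 1),
      (-1) ^ (j + 1) * ((l + 2 - (j + 1)).choose (j + 1) : MvPolynomial (Fin 3) ℤ) *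
        MvPolynomial.X 0 ^ (j + 1) * MvPolynomial.X 1 ^ (l + 2 - 2 * (j + 1))
      = MvPolynomial.X 1 * ((-1) ^ (j + 1) * ((l + 1 - (j + 1)).choose (j + 1) : MvPolynomial (Fin 3) ℤ) *
        MvPolynomial.X 0 ^ (j + 1) * MvPolynomial.X 1 ^ (l + 1 - 2 * (j + 1)))
        - MvPolynomial.X 0 * ((-1) ^ j * ((l - j).choose j : MvPolynomial (Fin 3) ℤ) *
        MvPolynomial.X 0 ^ j * MvPolynomial.X 1 ^ (l - 2 * j)) := by
    intro j hj
    rw [Finset.mem_range] at hj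
    rw [show l + 2 - (j + 1) = (l - j) + 1 by omega, show l + 1 - (j + 1) = l - j by omega,
      show l + 2 - 2 * (j + 1) = l - 2 * j by omega, Nat.choose_succ_succ']
    -- The exponents of $y$ match only if $2j+1\le l$; otherwise subtraction truncates, but the
    -- binomial in front vanishes.
    rcases Nat.lt_or_ge (l - j) (j + 1) with h | h
    · rw [Nat.choose_eq_zero_of_lt h]
      push_cast
      ring
    · rw [show l - 2 * j = (l + 1 - 2 * (j + 1)) + 1 by omega]
      push_cast
      ring
  rw [Finset.sum_congr rfl h, Finset.sum_sub_distrib, Nat.choose_eq_zero_of_lt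
    (show l + 2 - (l + 1 + 1) < l + 1 + 1 by omega)]
  simp
  ring

end FibPoly

namespace CyclicHopf

open FDComodule Finset.HasAntidiagonal

/-! ### Gaussian binomials at a root of unity -/

section QuantumIntegers

variable {k : Type u} [Field k] {q : k} {d : ℕ}

/-- Multiply by $q-1\ne0$: $(q-1)\,l_q=q^l-1$. -/
theorem qInt_eq_zero_iff (hd : 2 ≤ d) (hqd : orderOf q = d) (l : ℕ) : qInt q l = 0 ↔ d ∣ l := by
  have hq1 : q - 1 ≠ 0 := by
    rw [sub_ne_zero]
    rintro rfl
    rw [orderOf_one] at hqd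
    omega
  rw [← hqd, orderOf_dvd_iff_pow_eq_one, qInt, ← sub_eq_zero (a := q ^ l), ← mul_geom_sum,
    mul_eq_zero, or_iff_right hq1]

/-- The $q$-factorial of $d$ vanishes, while those of $m$ and $d-m$ do not. -/
theorem qBinom_orderOf_eq_zero (hd : 2 ≤ d) (hqd : orderOf q = d) {m : ℕ} (h0 : 0 < m)
    (hm : m < d) : qBinom q d m = 0 := by
  have h := qBinom_mul_qFact q m (d - m)
  have hne (r : ℕ) (hr : r < d) : qFact q r ≠ 0 := by
    refine Finset.prod_ne_zero_iff.2 fun i hi h => ?_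
    rw [Finset.mem_range] at hi
    have := Nat.le_of_dvd (Nat.succ_pos i) ((qInt_eq_zero_iff hd hqd _).1 h)
    omega
  have hz : qFact q d = 0 := by
    obtain ⟨e, rfl⟩ := Nat.exists_eq_add_of_lt (show 0 < d by omega)
    rw [zero_add] at *
    rw [qFact_succ, (qInt_eq_zero_iff hd hqd _).2 dvd_rfl, mul_zero]
  rw [Nat.add_sub_cancel' hm.le, hz] at h
  exact (mul_eq_zero.1 h).resolve_right (mul_ne_zero (hne _ hm) (hne _ (by omega)))

/-- A case of the $q$-Lucas theorem. In the Vandermonde sum for $dc+d$ only the terms $(d,0)$ and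
$(0,d)$ survive, and their powers of $q$ are $1$, so each step adds one. -/
theorem qBinom_mul_orderOf (hd : 2 ≤ d) (hqd : orderOf q = d) (c : ℕ) :
    qBinom q (d * c) d = c := by
  induction c with
  | zero => rw [mul_zero, qBinom_eq_zero q (by omega), Nat.cast_zero]
  | succ c ih =>
    rw [mul_add, mul_one, ← qBinom_vandermonde, Finset.sum_eq_add (d, 0) (0, d)]
    · have : q ^ d = 1 := hqd ▸ pow_orderOf_eq_one q
      simp [ih, pow_mul, this]
    · simp only [ne_eq, Prod.mk.injEq]
      omega
    · rintro ⟨s, t⟩ hst ⟨h1, h2⟩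
      rw [mem_antidiagonal] at hst
      simp only [ne_eq, Prod.mk.injEq] at hst h1 h2 ⊢
      rw [qBinom_orderOf_eq_zero hd hqd (show 0 < t by omega) (by omega), mul_zero]
    · simp
    · simp

end QuantumIntegers

/-! ### The presentation of the Green ring -/

variable {k : Type u} [Field k] {n : ℕ} [NeZero n] {q : k} {hq : q ^ n = 1}

/-- $[V(0,0)]$ is a left identity on the spanning classes, hence equals $1$. -/
theorem of_V_zero_zero : GreenRing.of (V hq 0 0) = 1 := by
  suffices h : ∀ x, GreenRing.of (V hq 0 0) * x = x by simpa using h 1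
  intro x
  obtain ⟨L, hL⟩ := exists_mem_filt x
  induction hL using AddSubgroup.closure_induction with
  | mem x h =>
    obtain ⟨j, m, -, rfl⟩ := h
    rw [of_V_zero_mul, zero_add]
  | zero => rw [mul_zero]
  | add x y _ _ hx hy => rw [mul_add, hx, hy]
  | neg x _ hx => rw [mul_neg, hx]

theorem of_V_pow (m : ℕ) : GreenRing.of (V hq 1 0) ^ m = GreenRing.of (V hq m 0) := by
  induction m with
  | zero => rw [pow_zero, Nat.cast_zero, of_V_zero_zero]
  | succ m ih => rw [pow_succ, ih, of_V_zero_mul, Nat.cast_succ]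

variable [CharZero k] {d : ℕ}

/-- The leading coefficient is governed by $c+1$; this is where characteristic $0$ enters. -/
theorem V_d_mul_sub_mem_filt (hd : 2 ≤ d) (hqd : orderOf q = d) (c : ℕ) :
    GreenRing.of (V hq 0 d) * GreenRing.of (V hq 0 (d * c)) - GreenRing.of (V hq 0 (d * (c + 1)))
      ∈ filt n q hq (d * (c + 1)) := by
  have h := of_mul_of_sub_mem_filt (hq := hq) (i := 0) (j := 0) (a := d) (b := d * c) (by
    rw [show d + d * c = d * (c + 1) by ring, qBinom_mul_orderOf hd hqd]
    exact Nat.cast_ne_zero.2 (Nat.succ_ne_zero c))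
  rwa [zero_add, show d + d * c = d * (c + 1) by ring] at h

omit [CharZero k] in
theorem V_one_mul_sub_mem_filt {l : ℕ} (h : qInt q (l + 1) ≠ 0) :
    GreenRing.of (V hq 0 1) * GreenRing.of (V hq 0 l) - GreenRing.of (V hq 0 (l + 1))
      ∈ filt n q hq (l + 1) := by
  have h := of_mul_of_sub_mem_filt (hq := hq) (i := 0) (j := 0) (a := 1) (b := l) (by
    rwa [add_comm, qBinom_one_right])
  rwa [zero_add, add_comm 1 l] at h

variable (hq) in
-- Strong induction on $l$: up to terms already reached, $[V(0,l)]$ is $z\,[V(0,l-d)]$ if $d\mid l$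
-- and $y\,[V(0,l-1)]$ otherwise. Powers of $x$ shift the vertex.
theorem closure_eq_top (hd : 2 ≤ d) (hqd : orderOf q = d) :
    Subring.closure {GreenRing.of (V hq 1 0), GreenRing.of (V hq 0 1), GreenRing.of (V hq 0 d)}
      = ⊤ := by
  set S := Subring.closure
    {GreenRing.of (V hq 1 0), GreenRing.of (V hq 0 1), GreenRing.of (V hq 0 d)} with hS
  have hx : GreenRing.of (V hq 1 0) ∈ S := Subring.subset_closure (by simp)
  have hy : GreenRing.of (V hq 0 1) ∈ S := Subring.subset_closure (by simp)
  have hz : GreenRing.of (V hq 0 d) ∈ S := Subring.subset_closure (by simp)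
  have hV : ∀ l i, GreenRing.of (V hq i l) ∈ S := by
    intro l
    induction l using Nat.strong_induction_on with
    | _ l ih =>
      intro i
      have hf : filt n q hq l ≤ S.toAddSubgroup := by
        refine (AddSubgroup.closure_le _).2 ?_
        rintro _ ⟨j, m, hm, rfl⟩
        exact ih m hm j
      suffices h0 : GreenRing.of (V hq 0 l) ∈ S by
        have := mul_mem (pow_mem hx i.val) h0
        rwa [of_V_pow, of_V_zero_mul, add_zero, ZMod.natCast_zmod_val] at this
      rcases Nat.eq_zero_or_pos l with rfl | hl
      · rw [of_V_zero_zero]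
        exact one_mem S
      · by_cases hdl : d ∣ l
        · obtain ⟨c, rfl⟩ := hdl
          obtain ⟨c, rfl⟩ := Nat.exists_eq_succ_of_ne_zero (Nat.pos_of_mul_pos_left hl).ne'
          have := sub_mem (mul_mem hz (ih (d * c) (by
            rw [Nat.succ_eq_add_one, mul_add]; omega) 0)) (hf (V_d_mul_sub_mem_filt hd hqd c))
          rwa [sub_sub_cancel] at this
        · obtain ⟨m, rfl⟩ := Nat.exists_eq_succ_of_ne_zero hl.ne'
          have := sub_mem (mul_mem hy (ih m (Nat.lt_succ_self m) 0)) (hf (V_one_mul_sub_mem_filt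
            fun h => hdl ((qInt_eq_zero_iff hd hqd _).1 h)))
          rwa [sub_sub_cancel] at this
  refine (Subring.eq_top_iff' S).2 fun x => ?_
  obtain ⟨L, hL⟩ := exists_mem_filt x
  have : filt n q hq L ≤ S.toAddSubgroup := by
    refine (AddSubgroup.closure_le _).2 ?_
    rintro _ ⟨j, m, -, rfl⟩
    exact hV m j
  exact this hL

omit [CharZero k] in
theorem not_dvd_succ {a : ℕ} (c : ℕ) (ha : a + 1 < d) : ¬ d ∣ d * c + a + 1 := by
  rw [add_assoc, Nat.dvd_add_right (dvd_mul_right d c)]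
  exact Nat.not_dvd_of_pos_of_lt (Nat.succ_pos a) ha

omit [CharZero k] in
-- The centralizer of the generators is everything, so the generators are central, and so is all
-- they generate.
theorem mul_comm_of_closure_eq_top {R : Type*} [Ring R] {s : Set R} (htop : Subring.closure s = ⊤)
    (hcomm : ∀ a ∈ s, ∀ b ∈ s, a * b = b * a) (a b : R) : a * b = b * a := by
  have h1 : Subring.closure s ≤ Subring.centralizer s :=
    Subring.closure_le.2 fun a ha => Subring.mem_centralizer_iff.2 fun b hb => hcomm b hb a ha
  have h2 : Subring.closure s ≤ Subring.center _ := Subring.closure_le.2 fun b hb =>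
    Subring.mem_center_iff.2 fun a =>
      (Subring.mem_centralizer_iff.1 (h1 (htop ▸ Subring.mem_top a)) b hb).symm
  exact (Subring.mem_center_iff.1 (h2 (htop ▸ Subring.mem_top b)) a)

variable (hq) in
theorem greenRing_mul_comm (hd : 2 ≤ d) (hqd : orderOf q = d)
    (a b : GreenRing k (CyclicHopf n q hq)) : a * b = b * a := by
  have hx (j : ZMod n) (l : ℕ) : GreenRing.of (V hq 1 0) * GreenRing.of (V hq j l)
      = GreenRing.of (V hq j l) * GreenRing.of (V hq 1 0) := by
    rw [of_V_zero_mul, of_mul_V_zero, add_comm]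
  have hyz : GreenRing.of (V hq 0 1) * GreenRing.of (V hq 0 d)
      = GreenRing.of (V hq 0 d) * GreenRing.of (V hq 0 1) := by
    obtain ⟨l, rfl⟩ := Nat.exists_eq_succ_of_ne_zero (show d ≠ 0 by omega)
    -- Here $d=l+1$, and $d\nmid d+1$ because $d\ge2$. So both orders of the product have the same
    -- explicit splitting.
    have h : qInt q (l + 2) ≠ 0 := by
      rw [Ne, qInt_eq_zero_iff hd hqd, show l + 2 = (l + 1) + 1 by rfl, Nat.dvd_add_right dvd_rfl]
      exact Nat.not_dvd_of_pos_of_lt one_pos (by omega)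
    exact (V_one_mul_V h).trans (V_mul_V_one h).symm
  have h1 := hx 0 1
  have h2 := hx 0 d
  have htop := closure_eq_top hq hd hqd
  generalize GreenRing.of (V hq 1 0) = x at *
  generalize GreenRing.of (V hq 0 1) = y at *
  generalize GreenRing.of (V hq 0 d) = z at *
  refine mul_comm_of_closure_eq_top htop ?_ a b
  rintro a (rfl | rfl | rfl) b (rfl | rfl | rfl)
  · rfl
  · exact h1
  · exact h2
  · exact h1.symm
  · rfl
  · exact hyz
  · exact h2.symm
  · exact hyz.symm
  · rfl

variable (hq) in
theorem exists_ringHom (hd : 2 ≤ d) (hqd : orderOf q = d) :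
    ∃ φ : MvPolynomial (Fin 3) ℤ →+* GreenRing k (CyclicHopf n q hq),
      φ (MvPolynomial.X 0) = GreenRing.of (V hq 1 0) ∧
      φ (MvPolynomial.X 1) = GreenRing.of (V hq 0 1) ∧
      φ (MvPolynomial.X 2) = GreenRing.of (V hq 0 d) := by
  let _ : CommRing (GreenRing k (CyclicHopf n q hq)) :=
    { (inferInstance : Ring (GreenRing k (CyclicHopf n q hq))) with
      mul_comm := greenRing_mul_comm hq hd hqd }
  exact ⟨MvPolynomial.eval₂Hom (Int.castRingHom (GreenRing k (CyclicHopf n q hq)))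
    ![GreenRing.of (V hq 1 0), GreenRing.of (V hq 0 1), GreenRing.of (V hq 0 d)],
    by simp, by simp, by simp⟩

end CyclicHopf

/-! ### A spanning set of the quotient by `relIdeal` -/

section Spanning

open MvPolynomial

/-- The classes of the elements `x^m f_a z^c` with `a < d`. -/
def spanningSet (n d : ℕ) : Set (MvPolynomial (Fin 3) ℤ ⧸ relIdeal n d) :=
  {b | ∃ m a c, a < d ∧ b = Ideal.Quotient.mk _ (X 0 ^ m * fibPoly (a + 1) * X 2 ^ c)}

theorem mk_X_one_mul_fibPoly (n d : ℕ) :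
    Ideal.Quotient.mk (relIdeal n d) (X 1 * fibPoly d)
      = Ideal.Quotient.mk (relIdeal n d) (X 0 * fibPoly d + fibPoly d) := by
  rw [Ideal.Quotient.eq]
  refine Ideal.subset_span (Or.inr ?_)
  rw [Set.mem_singleton_iff]
  ring

/-- The span contains $1$ and is stable under the three variables. Only $y$ needs an argument: below
the top the recurrence gives $yf_a=f_{a+1}+xf_{a-1}$, and at $a=d-1$ the relation gives
$yf_a=xf_a+f_a$. -/
theorem span_spanningSet {n d : ℕ} (hd : 0 < d) : Submodule.span ℤ (spanningSet n d) = ⊤ := by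
  set S := Submodule.span ℤ (spanningSet n d) with hS
  have mem (m a c : ℕ) (ha : a < d) :
      Ideal.Quotient.mk (relIdeal n d) (X 0 ^ m * fibPoly (a + 1) * X 2 ^ c) ∈ S :=
    Submodule.subset_span ⟨m, a, c, ha, rfl⟩
  have hX (j : Fin 3) (m a c : ℕ) (ha : a < d) : Ideal.Quotient.mk (relIdeal n d)
      (X j * (X 0 ^ m * fibPoly (a + 1) * X 2 ^ c)) ∈ S := by
    fin_cases j
    · convert mem (m + 1) a c ha using 2
      simp only [Fin.zero_eta]
      ring
    · rcases Nat.lt_or_ge (a + 1) d with had | had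
      · rcases a with - | a
        · convert mem m 1 c had using 2
          simp only [Fin.mk_one, zero_add, fibPoly_one, Nat.reduceAdd, fibPoly_two]
          ring
        · have := add_mem (mem m (a + 2) c had) (mem (m + 1) a c (by omega))
          rw [← map_add, fibPoly_add_three] at this
          convert this using 2
          simp only [Fin.mk_one]
          ring
      · obtain rfl : a + 1 = d := by omega
        have := add_mem (mem (m + 1) a c ha) (mem m a c ha)
        rw [← map_add] at this
        convert this using 1
        have e := congrArg (Ideal.Quotient.mk (relIdeal n (a + 1)) (X 0 ^ m * X 2 ^ c) * ·)
          (mk_X_one_mul_fibPoly n (a + 1))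
        simp only [← map_mul] at e
        convert e using 2
        · simp only [Fin.mk_one]
          ring
        · ring
    · convert mem m a (c + 1) ha using 2
      simp only [Fin.reduceFinMk]
      ring
  have hmul (j : Fin 3) {b : MvPolynomial (Fin 3) ℤ ⧸ relIdeal n d} (hb : b ∈ S) :
      b * Ideal.Quotient.mk _ (X j) ∈ S := by
    induction hb using Submodule.span_induction with
    | mem b h =>
      obtain ⟨m, a, c, ha, rfl⟩ := h
      rw [← map_mul, mul_comm]
      exact hX j m a c ha
    | zero => rw [zero_mul]; exact zero_mem _
    | add a b _ _ ha hb => rw [add_mul]; exact add_mem ha hb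
    | smul r b _ hb => rw [smul_mul_assoc]; exact S.smul_mem r hb
  refine (Submodule.eq_top_iff'.2 fun b => ?_)
  obtain ⟨p, rfl⟩ := Ideal.Quotient.mk_surjective b
  induction p using MvPolynomial.induction_on with
  | C r =>
    have := S.smul_mem r (mem 0 0 0 hd)
    rw [zero_add, fibPoly_one, pow_zero, pow_zero, mul_one, mul_one, map_one] at this
    convert this using 1
    rw [zsmul_eq_mul, mul_one]
    simp
  | add p p' hp hp' => rw [map_add]; exact add_mem hp hp'
  | mul_X p j hp => rw [map_mul]; exact hmul j hp

/-- The class of `x^i f_a z^c`, where `l = d c + a` with `a < d`. -/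
noncomputable def relBasis (n d : ℕ) (x : ZMod n × ℕ) : MvPolynomial (Fin 3) ℤ ⧸ relIdeal n d :=
  Ideal.Quotient.mk _ (X 0 ^ x.1.val * fibPoly (x.2 % d + 1) * X 2 ^ (x.2 / d))

/-- The relation $x^n=1$ reduces the exponent of $x$ modulo $n$, and $(a,c)$ with $a<d$ is encoded
as $dc+a$. -/
theorem span_range_relBasis {n d : ℕ} [NeZero n] (hd : 0 < d) :
    Submodule.span ℤ (Set.range (relBasis n d)) = ⊤ := by
  rw [← top_le_iff, ← span_spanningSet hd]
  refine Submodule.span_mono ?_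
  rintro _ ⟨m, a, c, ha, rfl⟩
  refine ⟨((m : ZMod n), d * c + a), ?_⟩
  have hx : Ideal.Quotient.mk (relIdeal n d) (X 0) ^ n = 1 := by
    rw [← map_pow, ← map_one (Ideal.Quotient.mk (relIdeal n d)), Ideal.Quotient.eq]
    exact Ideal.subset_span (Or.inl rfl)
  simp only [relBasis, map_mul, map_pow, ZMod.val_natCast, ← pow_eq_pow_mod _ hx]
  rw [Nat.mul_add_mod, Nat.mod_eq_of_lt ha, Nat.mul_add_div hd, Nat.div_eq_of_lt ha, add_zero]

end Spanning

/-! ### Relations, leading terms and injectivity -/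

namespace CyclicHopf

open FDComodule MvPolynomial

variable {k : Type u} [Field k] {n : ℕ} [NeZero n] {q : k} {hq : q ^ n = 1} {d : ℕ}

theorem map_fibPoly (hd : 2 ≤ d) (hqd : orderOf q = d)
    {φ : MvPolynomial (Fin 3) ℤ →+* GreenRing k (CyclicHopf n q hq)}
    (h0 : φ (X 0) = GreenRing.of (V hq 1 0)) (h1 : φ (X 1) = GreenRing.of (V hq 0 1)) :
    ∀ a < d, φ (fibPoly (a + 1)) = GreenRing.of (V hq 0 a)
  | 0, _ => by rw [fibPoly_one, map_one, of_V_zero_zero]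
  | 1, _ => by rw [fibPoly_two, h1]
  | a + 2, h => by
    have hne : qInt q (a + 2) ≠ 0 := by
      rw [Ne, qInt_eq_zero_iff hd hqd]
      exact Nat.not_dvd_of_pos_of_lt (Nat.succ_pos _) h
    rw [fibPoly_add_three, map_sub, map_mul, map_mul, h0, h1,
      map_fibPoly hd hqd h0 h1 (a + 1) (by omega), map_fibPoly hd hqd h0 h1 a (by omega),
      V_one_mul_V hne, of_V_zero_mul, add_zero, add_sub_cancel_right]

/-- The second generator goes to $0$ by `V_one_mul_V_of_qInt_eq_zero` at $l=d-1$, where $l+1=d$ and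
$d_q=0$. -/
theorem map_relIdeal (hd : 2 ≤ d) (hqd : orderOf q = d)
    {φ : MvPolynomial (Fin 3) ℤ →+* GreenRing k (CyclicHopf n q hq)}
    (h0 : φ (X 0) = GreenRing.of (V hq 1 0)) (h1 : φ (X 1) = GreenRing.of (V hq 0 1)) :
    ∀ p ∈ relIdeal n d, φ p = 0 := by
  have : relIdeal n d ≤ RingHom.ker φ := by
    refine Ideal.span_le.2 ?_
    rintro _ (rfl | rfl)
    · rw [SetLike.mem_coe, RingHom.mem_ker, map_sub, map_pow, h0, of_V_pow, ZMod.natCast_self,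
        of_V_zero_zero, map_one, sub_self]
    · obtain ⟨a, rfl⟩ := Nat.exists_eq_succ_of_ne_zero (show d ≠ 0 by omega)
      rw [SetLike.mem_coe, RingHom.mem_ker, map_mul, map_sub, map_sub, h0, h1, map_one,
        map_fibPoly hd hqd h0 h1 a (Nat.lt_succ_self a), sub_mul, sub_mul,
        V_one_mul_V_of_qInt_eq_zero ((qInt_eq_zero_iff hd hqd _).2 dvd_rfl), of_V_zero_mul,
        add_zero, one_mul]
      abel
  exact this

variable [CharZero k]

theorem map_pow_sub_mem_filt (hd : 2 ≤ d) (hqd : orderOf q = d) (c : ℕ) :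
    GreenRing.of (V hq 0 d) ^ c - GreenRing.of (V hq 0 (d * c)) ∈ filt n q hq (d * c) := by
  induction c with
  | zero => rw [pow_zero, mul_zero, of_V_zero_zero, sub_self]; exact zero_mem _
  | succ c ih =>
    have := add_mem (of_mul_mem_filt (i := 0) (a := d) ih) (V_d_mul_sub_mem_filt hd hqd c)
    rwa [mul_sub, sub_add_sub_cancel, ← pow_succ'] at this

/-- The leading term of the image of `f_a z^c`. -/
theorem map_fibPoly_mul_sub_mem_filt (hd : 2 ≤ d) (hqd : orderOf q = d)
    {φ : MvPolynomial (Fin 3) ℤ →+* GreenRing k (CyclicHopf n q hq)}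
    (h0 : φ (X 0) = GreenRing.of (V hq 1 0)) (h1 : φ (X 1) = GreenRing.of (V hq 0 1))
    (h2 : φ (X 2) = GreenRing.of (V hq 0 d)) (c : ℕ) :
    ∀ a < d, φ (fibPoly (a + 1) * X 2 ^ c) - GreenRing.of (V hq 0 (d * c + a))
      ∈ filt n q hq (d * c + a)
  | 0, _ => by
    rw [fibPoly_one, one_mul, map_pow, h2]
    exact map_pow_sub_mem_filt hd hqd c
  | 1, h => by
    have hne : qInt q (d * c + 1) ≠ 0 := by
      rw [Ne, qInt_eq_zero_iff hd hqd]
      exact not_dvd_succ (a := 0) c h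
    rw [fibPoly_two, map_mul, map_pow, h1, h2]
    have := add_mem (of_mul_mem_filt (i := 0) (a := 1) (map_pow_sub_mem_filt (hq := hq) hd hqd c))
      (V_one_mul_sub_mem_filt hne)
    rwa [mul_sub, sub_add_sub_cancel] at this
  | a + 2, h => by
    have hne : qInt q (d * c + (a + 1) + 1) ≠ 0 := by
      rw [Ne, qInt_eq_zero_iff hd hqd]
      exact not_dvd_succ (a := a + 1) c h
    have i1 := map_fibPoly_mul_sub_mem_filt hd hqd h0 h1 h2 c (a + 1) (by omega)
    have i2 := map_fibPoly_mul_sub_mem_filt hd hqd h0 h1 h2 c a (by omega)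
    have e1 := add_mem (of_mul_mem_filt (i := 0) (a := 1) i1) (V_one_mul_sub_mem_filt hne)
    -- The subtracted term $x f_a z^c$ of the recurrence lies below the leading index $dc+a+2$.
    have e2 : φ (X 0) * φ (fibPoly (a + 1) * X 2 ^ c) ∈ filt n q hq (d * c + a + 1) := by
      have := add_mem (filt_mono (Nat.le_succ _) i2) (of_V_mem_filt 0 (Nat.lt_succ_self _))
      rw [sub_add_cancel] at this
      rw [h0]
      exact of_mul_mem_filt (a := 0) this
    have e3 := sub_mem e1 (filt_mono (by omega) e2)
    rw [mul_sub, sub_add_sub_cancel] at e3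
    rw [fibPoly_add_three, sub_mul, map_sub, mul_assoc, mul_assoc, map_mul φ (X 1),
      map_mul φ (X 0), h1, sub_right_comm]
    exact e3

variable (hq) in
-- Unitriangularity: the image of the element indexed by $(j,l)$ is $[V(j,l)]$ modulo `filt l`, and
-- the ranks of length $L\ge l$ do not see `filt l`.
theorem rankHom_map_relBasis (hd : 2 ≤ d) (hqd : orderOf q = d)
    {φ : (MvPolynomial (Fin 3) ℤ ⧸ relIdeal n d) →+* GreenRing k (CyclicHopf n q hq)}
    (h0 : φ (Ideal.Quotient.mk _ (X 0)) = GreenRing.of (V hq 1 0))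
    (h1 : φ (Ideal.Quotient.mk _ (X 1)) = GreenRing.of (V hq 0 1))
    (h2 : φ (Ideal.Quotient.mk _ (X 2)) = GreenRing.of (V hq 0 d)) (i j : ZMod n) {l L : ℕ}
    (hl : l ≤ L) :
    rankHom n q hq i L (φ (relBasis n d (j, l))) = if (j, l) = (i, L) then 1 else 0 := by
  have h := map_fibPoly_mul_sub_mem_filt (φ := φ.comp (Ideal.Quotient.mk _)) hd hqd h0 h1 h2
    (l / d) (l % d) (Nat.mod_lt _ (by omega))
  rw [Nat.div_add_mod] at h
  have h' := of_mul_mem_filt (i := j) (a := 0) h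
  rw [mul_sub, of_V_zero_mul, add_zero, add_zero] at h'
  have e : φ (relBasis n d (j, l)) = GreenRing.of (V hq j 0) *
      φ.comp (Ideal.Quotient.mk _) (fibPoly (l % d + 1) * X 2 ^ (l / d)) := by
    rw [relBasis, mul_assoc, map_mul, map_mul, map_pow, map_pow, h0, of_V_pow,
      ZMod.natCast_zmod_val]
    rfl
  rw [← e] at h'
  have hr := rankHom_of_mem_filt (i := i) hl h'
  rw [map_sub, sub_eq_zero] at hr
  rw [hr]
  rcases hl.lt_or_eq with hl | rfl
  · rw [rankHom_of_mem_filt le_rfl (of_V_mem_filt j hl), if_neg]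
    rw [Prod.mk.injEq]
    omega
  · rw [rankHom_V]
    simp [eq_comm]

theorem injective_of_map_X (hd : 2 ≤ d) (hqd : orderOf q = d)
    {φ : (MvPolynomial (Fin 3) ℤ ⧸ relIdeal n d) →+* GreenRing k (CyclicHopf n q hq)}
    (h0 : φ (Ideal.Quotient.mk _ (X 0)) = GreenRing.of (V hq 1 0))
    (h1 : φ (Ideal.Quotient.mk _ (X 1)) = GreenRing.of (V hq 0 1))
    (h2 : φ (Ideal.Quotient.mk _ (X 2)) = GreenRing.of (V hq 0 d)) : Function.Injective φ := by
  refine (injective_iff_map_eq_zero φ).2 fun p hp => ?_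
  have hspan : p ∈ Submodule.span ℤ (Set.range (relBasis n d)) :=
    span_range_relBasis (n := n) (show 0 < d by omega) ▸ Submodule.mem_top
  obtain ⟨c, rfl⟩ := Finsupp.mem_span_range_iff_exists_finsupp.1 hspan
  suffices hc : c = 0 by rw [hc, Finsupp.sum_zero_index]
  by_contra hc
  -- In a relation among the images, an index $(i,L)$ with $L$ maximal is chosen; the rank
  -- functional at $(i,L)$ then returns its coefficient alone.
  obtain ⟨⟨i, L⟩, hiL, hmax⟩ := c.support.exists_max_image Prod.snd
    (Finsupp.support_nonempty_iff.2 hc)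
  have h := congrArg (rankHom n q hq i L) hp
  rw [Finsupp.sum, map_sum, map_sum, map_zero, Finset.sum_eq_single (i, L)] at h
  · rw [map_zsmul, map_zsmul, rankHom_map_relBasis hq hd hqd h0 h1 h2 _ _ le_rfl, if_pos rfl,
      smul_eq_mul, mul_one] at h
    exact Finsupp.mem_support_iff.1 hiL h
  · rintro ⟨j, l⟩ hjl hne
    rw [map_zsmul, map_zsmul, rankHom_map_relBasis hq hd hqd h0 h1 h2 _ _ (hmax _ hjl),
      if_neg hne, smul_zero]
  · exact fun hn => absurd hiL hn

end CyclicHopf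

/-- The Green ring of the category of finite-dimensional right `k𝒵(q)`-comodules, for `q` an `n`-th
root of unity of order `d ≥ 2`, is `ℤ[x, y, z] / J`, with `x`, `y`, `z` corresponding to
`[V(1, 0)]`, `[V(0, 1)]`, `[V(0, d)]`. -/
theorem theorem3p25 {k : Type u} [Field k] [IsAlgClosed k] [CharZero k]
    (n : ℕ) [NeZero n] (q : k) (hq : q ^ n = 1) (d : ℕ) (hd : 2 ≤ d) (hqd : orderOf q = d) :
    ∃ e : (MvPolynomial (Fin 3) ℤ ⧸ relIdeal n d) ≃+* GreenRing k (CyclicHopf n q hq),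
      e (Ideal.Quotient.mk (relIdeal n d) (MvPolynomial.X 0)) =
        GreenRing.of (CyclicHopf.V hq 1 0) ∧
      e (Ideal.Quotient.mk (relIdeal n d) (MvPolynomial.X 1)) =
        GreenRing.of (CyclicHopf.V hq 0 1) ∧
      e (Ideal.Quotient.mk (relIdeal n d) (MvPolynomial.X 2)) =
        GreenRing.of (CyclicHopf.V hq 0 d) := by
  obtain ⟨φ, h0, h1, h2⟩ := CyclicHopf.exists_ringHom hq hd hqd
  let ψ : (MvPolynomial (Fin 3) ℤ ⧸ relIdeal n d) →+* GreenRing k (CyclicHopf n q hq) :=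
    Ideal.Quotient.lift _ φ (CyclicHopf.map_relIdeal hd hqd h0 h1)
  have hψ (p) : ψ (Ideal.Quotient.mk _ p) = φ p := Ideal.Quotient.lift_mk _ _ _
  have hinj : Function.Injective ψ := CyclicHopf.injective_of_map_X hd hqd
    ((hψ _).trans h0) ((hψ _).trans h1) ((hψ _).trans h2)
  have hsurj : Function.Surjective ψ := by
    rw [← RingHom.range_eq_top, ← top_le_iff, ← CyclicHopf.closure_eq_top hq hd hqd,
      Subring.closure_le]
    rintro _ (rfl | rfl | rfl)
    · exact ⟨_, (hψ _).trans h0⟩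
    · exact ⟨_, (hψ _).trans h1⟩
    · exact ⟨_, (hψ _).trans h2⟩
  exact ⟨RingEquiv.ofBijective ψ ⟨hinj, hsurj⟩, (hψ _).trans h0, (hψ _).trans h1, (hψ _).trans h2⟩
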